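/- Let $\sigma>0$. For $\alpha,\beta>0$ with $\alpha\beta>1$ put $\gamma^2=\alpha/\beta$ ($\gamma>0$), $\coth\delta=\alpha\beta$ ($\delta>0$), $\rho=e^{-\delta}$, and let $H_k$, $k=0,1,\dots$, be the Hermite functions, normalised in $L^2(\mathbb{R})$, and $(D_\gamma H_k)(t)=\gamma^{-1/2}H_k(t/\gamma)$. Consider the nonstationary Gaussian source $$X(t)=\sum_{k=0}^\infty X_k\,(D_\gamma H_k)(t),\qquad t\in\mathbb{R},$$ with independent coefficients $X_k\sim\mathcal N(0,\sigma^2\rho^{2k+1})$; for each $t$ the series converges almost surely. With $r(t_1,t_2)=\mathbb{E}[X(t_1)X(t_2)]$, the Wigner–Ville spectrum of the source is $$\Phi(t,\omega)=\frac1{2\pi}\int_{-\infty}^\infty e^{-i\omega s}\,r\!\left(t+\tfrac s2,t-\tfrac s2\right)ds=\frac{\sigma^2}{2\pi}\cdot\frac1{\cosh\delta}\exp\left(-\frac{t^2}{\alpha^2}-\frac{\omega^2}{\beta^2}\right).$$ The source is identified with its coefficient sequence $(X_0,X_1,\dots)$; an estimate $(\hat X_0,\hat X_1,\dots)$ has the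 average distortion $\mathbb{E}\left[\sum_{k=0}^\infty (X_k-\hat X_k)^2\right]$, and the rate distortion function $R(D)$, in nats per realization of the source, is the infimum of the mutual information of the two sequences over all joint laws with average distortion at most $D$. It depends on $\alpha,\beta$ only through $\alpha\beta$. Its average energy is $E=\sum_{k=0}^\infty\sigma^2\rho^{2k+1}$. For functions $A,B$ of $x=\alpha\beta\in(1,\infty)$ write $A\doteq B$ if $(A(x)-B(x))/x\to0$ as $x\to\infty$. **Theorem.** Let the average distortion $D=D(\alpha\beta)$ be a real function of $\alpha\beta\in(1,\infty)$ with $D(\alpha\beta)=\Omega(\alpha\beta)$, i.e. $\liminf_{x\to\infty}D(x)/x>0$. Then the rate $R=R(D(\alpha\beta))$, which is finite whenever $D(\alpha\beta)>0$, satisfies $$R\doteq\frac1{2\pi}\iint_{\mathbb{R}^2}\max\left\{0,\frac12\ln\frac{\Phi(t,\omega)}{\lambda}\right\}dt\,d\omega$$ for every choice of $\lambda=\lambda(\alpha\beta)>0$ such that $$D\doteq\iint_{\mathbb{R}^2}\min\{\lambda,\Phi(t,\omega)\}\,dt\,d\omega,$$ all these double integrals being absolutely convergent; and such a $\lambda$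 exists whenever $D(\alpha\beta)\le E(\alpha\beta)$ for all large $\alpha\beta$. -/

import Mathlib

open MeasureTheory ProbabilityTheory Filter
open scoped ENNReal NNReal Topology

noncomputable section

/-! ### Asymptotic notation for functions on `(1, ∞)` -/

/-- `A ≐ B`, that is, `A x = B x + o(x)` as `x → ∞`. Only large `x` matter. -/
def DotEq (A B : ℝ → ℝ) : Prop :=
  Tendsto (fun x : ℝ => (A x - B x) / x) atTop (𝓝 0)

/-- `A = Ω(B)` as `x → ∞`: `B > 0` on `(1, ∞)` and `liminf A / B > 0`. The limit inferior is
taken in the extended reals, so that it always exists. -/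
def IsBigOmega (A B : ℝ → ℝ) : Prop :=
  (∀ x : ℝ, 1 < x → 0 < B x) ∧
    (0 : EReal) < liminf (fun x : ℝ => ((A x / B x : ℝ) : EReal)) atTop

/-! ### Parameters; `x` is the time-frequency product `α β > 1` -/

/-- `δ > 0` with `coth δ = x`, i.e. `tanh δ = 1 / x`. -/
def delta (x : ℝ) : ℝ := Real.artanh (1 / x)

/-- `ρ = e^{-δ}`. -/
def rho (x : ℝ) : ℝ := Real.exp (-delta x)

/-- The variance `σ² ρ^{2k+1}` of the `k`-th coefficient. -/
def coeffVar (σ x : ℝ) (k : ℕ) : ℝ := σ ^ 2 * rho x ^ (2 * k + 1)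

/-- The average energy `E = ∑ₖ σ² ρ^{2k+1}` of the source. -/
def sourceEnergy (σ x : ℝ) : ℝ := ∑' k : ℕ, coeffVar σ x k

/-! ### The source -/

/-- The `k`-th Hermite function, normalised in `L²(ℝ)`, in terms of the probabilists' Hermite
polynomials `Heₖ` (the physicists' polynomial is `2^{k/2} Heₖ(√2 t)`). -/
def hermiteFun (k : ℕ) (t : ℝ) : ℝ :=
  Polynomial.aeval (√2 * t) (Polynomial.hermite k) * Real.exp (-t ^ 2 / 2) /
    √((k.factorial : ℝ) * √Real.pi)

/-- The dilation `(D_γ f)(t) = γ^{-1/2} f(t / γ)`. -/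
def dilate (γ : ℝ) (f : ℝ → ℝ) (t : ℝ) : ℝ := (√γ)⁻¹ * f (t / γ)

/-- The law of the coefficient sequence `(X₀, X₁, …)`: independent, `Xₖ ~ N(0, σ² ρ^{2k+1})`. -/
def coeffLaw (σ x : ℝ) : Measure (ℕ → ℝ) :=
  Measure.infinitePi fun k => gaussianReal 0 (coeffVar σ x k).toNNReal

/-- The process `X(t) = ∑ₖ Xₖ (D_γ Hₖ)(t)`, `γ² = α / β`, on the sample space of coefficient
sequences `w = (X₀, X₁, …)`, which carries the probability measure `coeffLaw σ (α * β)`. -/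
def process (α β : ℝ) (t : ℝ) (w : ℕ → ℝ) : ℝ :=
  ∑' k : ℕ, w k * dilate (√(α / β)) (hermiteFun k) t

/-- The autocorrelation function `r(t₁, t₂) = E[X(t₁) X(t₂)]` (the process is real). -/
def autocorr (σ α β t₁ t₂ : ℝ) : ℝ :=
  ∫ w, process α β t₁ w * process α β t₂ w ∂(coeffLaw σ (α * β))

/-- The Wigner-Ville spectrum
`Φ(t, ω) = (2π)⁻¹ ∫ e^{-iωs} r(t + s/2, t - s/2) ds`, as a complex number. -/
def wignerVilleC (σ α β t ω : ℝ) : ℂ :=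
  (2 * (Real.pi : ℂ))⁻¹ *
    ∫ s : ℝ, Complex.exp (-(Complex.I * ω * s)) * (autocorr σ α β (t + s / 2) (t - s / 2) : ℂ)

/-- The Wigner-Ville spectrum as a real function on the time-frequency plane. -/
def wignerVille (σ α β : ℝ) (p : ℝ × ℝ) : ℝ := (wignerVilleC σ α β p.1 p.2).re

/-! ### Rate distortion function -/

/-- Mutual information, in nats, of the two components of a pair with joint law `P`. -/
def mutualInfo {S T : Type*} [MeasurableSpace S] [MeasurableSpace T] (P : Measure (S × T)) :
    ℝ≥0∞ :=
  InformationTheory.klDiv P (P.fst.prod P.snd)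

/-- The average squared-error distortion `E[∑ₖ (Xₖ - X̂ₖ)²]` under the joint law `P` of
`(X, X̂)`. -/
def avgDistortion (P : Measure ((ℕ → ℝ) × (ℕ → ℝ))) : ℝ≥0∞ :=
  ∫⁻ p, ∑' k : ℕ, ENNReal.ofReal ((p.1 k - p.2 k) ^ 2) ∂P

/-- The rate distortion function, in nats per realization, of a random sequence with law `μ`: the
infimum of the mutual information `I(X; X̂)` over all joint laws of `(X, X̂)` such that `X` has
law `μ` and the average distortion is at most `D`. -/
def rateDistortion (μ : Measure (ℕ → ℝ)) (D : ℝ) : ℝ≥0∞ :=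
  ⨅ (P : Measure ((ℕ → ℝ) × (ℕ → ℝ))) (_ : IsProbabilityMeasure P) (_ : P.fst = μ)
    (_ : avgDistortion P ≤ ENNReal.ofReal D), mutualInfo P

/-! ### Reverse waterfilling in the time-frequency plane -/

/-- The integrand of the rate: `max {0, ½ ln (Φ(t, ω) / l)}`. -/
def rateDensity (σ α β l : ℝ) (p : ℝ × ℝ) : ℝ :=
  max 0 (1 / 2 * Real.log (wignerVille σ α β p / l))

/-- The integrand of the distortion: `min {l, Φ(t, ω)}`. -/
def distortionDensity (σ α β l : ℝ) (p : ℝ × ℝ) : ℝ :=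
  min l (wignerVille σ α β p)

/-- `α, β` are positive functions of their product `x = α β`, for all `x > 1`. -/
def IsParam (α β : ℝ → ℝ) : Prop :=
  ∀ x : ℝ, 1 < x → 0 < α x ∧ 0 < β x ∧ α x * β x = x

end

/-! Both sides of the theorem are governed by one number, the water depth `L`. In the sequence
domain, a level `θ = σ² e^{-L}` leaves about `L / (2δ)` coefficients above water, since the
variances are `σ² e^{-δ(2k+1)}`. Reverse waterfilling then gives a rate of about `L² / (8δ)` and a
distortion of about `(σ²/2) x e^{-L} (1 + L)`, and `δ x → 1`. In the time-frequency plane, Mehler's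
formula makes the Wigner–Ville spectrum a Gaussian with elliptical level sets. The variable `u =
t²/α² + ω²/β²` carries area to `π x du`, so the double integrals become one-dimensional: with `L =
ln⁺(peak / λ)` the rate integral is exactly `x L² / 8` and the distortion integral exactly `E e^{-L}
(1 + L)`, where `E ~ σ² x / 2`.

Reverse waterfilling rests on two one-sided bounds, `le_rateDistortion` and `rateDistortion_le`. The
converse is a Donsker–Varadhan bound with a Gaussian log-likelihood ratio as test function. It is a
Lagrangian bound, affine in `D` and valid for every level `θ`, so that `D` need not match the level.
Achievability uses the backward Gaussian channel, written as a density with respect to the product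
of the marginals.

Since `D` agrees with the waterfilling distortion only up to `o(x)`, stability is needed
(`dotEq_rateDistortion`). The assumption `D = Ω(x)` bounds `L` by a constant `M`. Hence the slope
`1/(2θ)` of the converse bound stays bounded, and an `o(x)` change in `D` costs `o(x)` in rate. For
the upper bound the depth is raised by a small `κ`; this frees distortion of order `x`, uniformly
for `L ≤ M` (`distortionFraction_add_le`), which absorbs all errors. -/

/-! ### Product measures and a lower bound for the divergence -/

theorem lintegral_infinitePi_prod (μ : ℕ → Measure ℝ) [∀ k, IsProbabilityMeasure (μ k)]
    (s : Finset ℕ) {F : ℕ → ℝ → ℝ≥0∞} (hF : ∀ k, Measurable (F k)) :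
    ∫⁻ x, ∏ k ∈ s, F k (x k) ∂(Measure.infinitePi μ) = ∏ k ∈ s, ∫⁻ x, F k x ∂(μ k) := by
  refine (lintegral_prod_eq_prod_lintegral_of_indepFun s (fun k (x : ℕ → ℝ) => F k (x k))
    (iIndepFun_infinitePi hF) (fun k => (hF k).comp (measurable_pi_apply k))).trans ?_
  refine Finset.prod_congr rfl fun k _ => ?_
  rw [← Measure.infinitePi_map_eval μ k, lintegral_map (hF k) (by fun_prop)]

/-- Donsker–Varadhan: an exponential moment bound under `Q` bounds the divergence from below. -/
theorem ofReal_integral_le_klDiv {Ω : Type*} [MeasurableSpace Ω] {P Q : Measure Ω}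
    [IsProbabilityMeasure P] [IsProbabilityMeasure Q] {f : Ω → ℝ} (hf : Measurable f)
    (hfP : Integrable f P) (hfQ : ∫⁻ p, ENNReal.ofReal (Real.exp (f p)) ∂Q ≤ 1) :
    ENNReal.ofReal (∫ p, f p ∂P) ≤ InformationTheory.klDiv P Q := by
  by_cases h : InformationTheory.klDiv P Q = ∞
  · simp [h]
  obtain ⟨hac, hint⟩ := InformationTheory.klDiv_ne_top_iff.1 h
  have hexp : Integrable (fun p => Real.exp (f p)) Q := by
    refine ⟨by fun_prop, ?_⟩
    rw [hasFiniteIntegral_iff_ofReal (ae_of_all _ fun p => (Real.exp_pos _).le)]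
    exact hfQ.trans_lt ENNReal.one_lt_top
  have hle : ∫ p, Real.exp (f p) ∂Q ≤ 1 := by
    rw [integral_eq_lintegral_of_nonneg_ae (ae_of_all _ fun p => (Real.exp_pos _).le) (by fun_prop)]
    exact ENNReal.toReal_le_of_le_ofReal zero_le_one (by simpa using hfQ)
  have hpos : 0 < ∫ p, Real.exp (f p) ∂Q := integral_exp_pos hexp
  -- The bound is the nonnegativity of the divergence of `P` from `Q` tilted by `f`; the normalising
  -- constant has nonpositive logarithm and can be dropped.
  have hprob : IsProbabilityMeasure (Q.tilted f) := isProbabilityMeasure_tilted hexp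
  have hac' : P ≪ Q.tilted f := hac.trans (absolutelyContinuous_tilted hexp)
  have key := integral_llr_tilted_right hac hfP hexp hint
  have hint' := integrable_llr_tilted_right hac hfP hint hexp
  have hnn := InformationTheory.integral_llr_add_sub_measure_univ_nonneg hac' hint'
  have hlog : Real.log (∫ p, Real.exp (f p) ∂Q) ≤ 0 := Real.log_nonpos hpos.le hle
  rw [InformationTheory.klDiv_of_ac_of_integrable hac hint]
  apply ENNReal.ofReal_le_ofReal
  simp only [probReal_univ, add_sub_cancel_right] at hnn ⊢
  linarith

/-! ### One-dimensional Gaussian test densities -/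

/-- The logarithm of the density of `N(y, θ)` with respect to `N(0, v)`. -/
noncomputable def gaussianLogRatio (v θ x y : ℝ) : ℝ :=
  1 / 2 * Real.log (v / θ) + x ^ 2 / (2 * v) - (x - y) ^ 2 / (2 * θ)

@[fun_prop]
theorem measurable_gaussianLogRatio (v θ : ℝ) :
    Measurable fun p : ℝ × ℝ => gaussianLogRatio v θ p.1 p.2 := by
  unfold gaussianLogRatio; fun_prop

theorem exp_gaussianLogRatio {v θ : ℝ} (hv : 0 < v) (hθ : 0 < θ) (x y : ℝ) :
    Real.exp (gaussianLogRatio v θ x y) =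
      √v / √θ * Real.exp (x ^ 2 / (2 * v) - (x - y) ^ 2 / (2 * θ)) := by
  have : Real.exp (1 / 2 * Real.log (v / θ)) = √v / √θ := by
    rw [← Real.sqrt_div hv.le, Real.sqrt_eq_rpow, Real.rpow_def_of_pos (by positivity), mul_comm]
  rw [gaussianLogRatio, add_sub_assoc, Real.exp_add, this]

/-- This is the backward test channel: given the reproduction `y`, the source is `N(y, θ)`. It
yields both the normalisation over `x` and the distortion `θ`. -/
theorem gaussianReal_withDensity_gaussianLogRatio {v θ : ℝ} (hv : 0 < v) (hθ : 0 < θ) (y : ℝ) :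
    (gaussianReal 0 v.toNNReal).withDensity
      (fun x => ENNReal.ofReal (Real.exp (gaussianLogRatio v θ x y))) =
      gaussianReal y θ.toNNReal := by
  have hv' : v.toNNReal ≠ 0 := by simpa using hv
  have hθ' : θ.toNNReal ≠ 0 := by simpa using hθ
  rw [gaussianReal_of_var_ne_zero _ hv', gaussianReal_of_var_ne_zero _ hθ', ← withDensity_mul]
  rotate_left
  · exact measurable_gaussianPDF _ _
  · unfold gaussianLogRatio; fun_prop
  congr 1
  ext x
  simp only [Pi.mul_apply, gaussianPDF]
  rw [← ENNReal.ofReal_mul (gaussianPDFReal_nonneg _ _ _)]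
  congr 1
  rw [exp_gaussianLogRatio hv hθ, gaussianPDFReal, gaussianPDFReal, Real.coe_toNNReal _ hv.le,
    Real.coe_toNNReal _ hθ.le]
  rw [Real.sqrt_mul (by positivity), Real.sqrt_mul (by positivity) θ]
  have h1 : Real.exp (-(x - y) ^ 2 / (2 * θ)) = Real.exp (-(x - 0) ^ 2 / (2 * v)) *
      Real.exp (x ^ 2 / (2 * v) - (x - y) ^ 2 / (2 * θ)) := by
    rw [← Real.exp_add]; congr 1; ring
  rw [h1]
  have := Real.sqrt_pos.2 hv
  have := Real.sqrt_pos.2 hθ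
  field_simp

theorem lintegral_exp_gaussianLogRatio_left {v θ : ℝ} (hv : 0 < v) (hθ : 0 < θ) (y : ℝ) :
    ∫⁻ x, ENNReal.ofReal (Real.exp (gaussianLogRatio v θ x y)) ∂(gaussianReal 0 v.toNNReal) = 1 := by
  have h := congrArg (fun m : Measure ℝ => m Set.univ)
    (gaussianReal_withDensity_gaussianLogRatio hv hθ y)
  simpa using h

/-- The reproduction has variance `v - θ`, whence `θ ≤ v`. Completing the square in `y` turns the
weighted density into that of `N(x w / v, θ w / v)` with `w = v - θ`, the forward channel. For `θ =
v` the reproduction is a point mass at zero. -/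
theorem lintegral_exp_gaussianLogRatio_right {v θ : ℝ} (hθ : 0 < θ) (hv : θ ≤ v) (x : ℝ) :
    ∫⁻ y, ENNReal.ofReal (Real.exp (gaussianLogRatio v θ x y))
      ∂(gaussianReal 0 (v - θ).toNNReal) = 1 := by
  rcases hv.eq_or_lt with rfl | hlt
  · simp [gaussianLogRatio, hθ.ne']
  have hv0 : 0 < v := hθ.trans hlt
  set w := v - θ with hw
  have hw0 : 0 < w := sub_pos.2 hlt
  have hu0 : 0 < θ * w / v := by positivity
  have hw' : w.toNNReal ≠ 0 := by simpa using hw0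
  have hu' : (θ * w / v).toNNReal ≠ 0 := by simpa using hu0
  rw [gaussianReal_of_var_ne_zero _ hw', lintegral_withDensity_eq_lintegral_mul _
    (measurable_gaussianPDF _ _) (by unfold gaussianLogRatio; fun_prop),
    ← lintegral_gaussianPDF_eq_one (x * w / v) hu']
  congr 1
  ext y
  simp only [Pi.mul_apply, gaussianPDF]
  rw [← ENNReal.ofReal_mul (gaussianPDFReal_nonneg _ _ _)]
  congr 1
  rw [exp_gaussianLogRatio hv0 hθ, gaussianPDFReal, gaussianPDFReal, Real.coe_toNNReal _ hw0.le,
    Real.coe_toNNReal _ hu0.le, Real.sqrt_mul (by positivity), Real.sqrt_mul (by positivity)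
    (θ * w / v), Real.sqrt_div (by positivity), Real.sqrt_mul hθ.le]
  have h1 : Real.exp (-(y - x * w / v) ^ 2 / (2 * (θ * w / v))) = Real.exp (-(y - 0) ^ 2 / (2 * w)) *
      Real.exp (x ^ 2 / (2 * v) - (x - y) ^ 2 / (2 * θ)) := by
    rw [← Real.exp_add]; congr 1
    have : v = w + θ := by rw [hw]; ring
    rw [this]
    field_simp
    ring
  rw [h1]
  have := Real.sqrt_pos.2 hv0
  have := Real.sqrt_pos.2 hθ
  have := Real.sqrt_pos.2 hw0
  field_simp

/-- The test function for a component below the water level. The exponent is affine in `x`, so the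
moment generating function gives `exp((v - θ) y² / (2θ²))`, at most one precisely because `v ≤ θ`.
-/
theorem lintegral_exp_sub_gaussian_le {v θ : ℝ} (hv : 0 ≤ v) (hθ : 0 < θ) (h : v ≤ θ) (y : ℝ) :
    ∫⁻ x, ENNReal.ofReal (Real.exp (x ^ 2 / (2 * θ) - (x - y) ^ 2 / (2 * θ)))
      ∂(gaussianReal 0 v.toNNReal) ≤ 1 := by
  have h1 : ∀ x : ℝ, Real.exp (x ^ 2 / (2 * θ) - (x - y) ^ 2 / (2 * θ)) =
      Real.exp (-y ^ 2 / (2 * θ)) * Real.exp (y / θ * x) := by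
    intro x
    rw [← Real.exp_add]; congr 1; field_simp; ring
  have h2 : ∫ x, Real.exp (y / θ * x) ∂(gaussianReal 0 v.toNNReal) =
      Real.exp (v * (y / θ) ^ 2 / 2) := by
    have := mgf_fun_id_gaussianReal (μ := 0) (v := v.toNNReal)
    have := congrFun this (y / θ)
    simpa [mgf, hv] using this
  simp_rw [h1]
  rw [← ofReal_integral_eq_lintegral_ofReal ((integrable_exp_mul_gaussianReal _).const_mul _)
    (ae_of_all _ fun _ => by positivity), integral_const_mul, h2, ← Real.exp_add]
  rw [ENNReal.ofReal_le_one, Real.exp_le_one_iff]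
  have : -y ^ 2 / (2 * θ) + v * (y / θ) ^ 2 / 2 = (v - θ) * (y ^ 2 / (2 * θ ^ 2)) := by
    field_simp; ring
  rw [this]
  exact mul_nonpos_of_nonpos_of_nonneg (by linarith) (by positivity)

theorem lintegral_sq_sub_gaussianReal (y : ℝ) {θ : ℝ} (hθ : 0 ≤ θ) :
    ∫⁻ x, ENNReal.ofReal ((x - y) ^ 2) ∂(gaussianReal y θ.toNNReal) = ENNReal.ofReal θ := by
  have hL : MemLp (fun x : ℝ => x) 2 (gaussianReal y θ.toNNReal) :=
    memLp_id_gaussianReal' 2 (by simp)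
  have hint : Integrable (fun x : ℝ => (x - y) ^ 2) (gaussianReal y θ.toNNReal) :=
    (hL.sub (memLp_const y)).integrable_sq
  rw [← ofReal_integral_eq_lintegral_ofReal hint
    (ae_of_all _ fun _ => by positivity)]
  have := variance_fun_id_gaussianReal (μ := y) (v := θ.toNNReal)
  rw [variance_eq_integral (by fun_prop), integral_id_gaussianReal, Real.coe_toNNReal _ hθ] at this
  rw [this]

/-! ### Reverse waterfilling for independent Gaussian sequences -/

theorem map_fst_eval {P : Measure ((ℕ → ℝ) × (ℕ → ℝ))} {μ : ℕ → Measure ℝ}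
    [∀ k, IsProbabilityMeasure (μ k)] (h : P.fst = Measure.infinitePi μ) (k : ℕ) :
    P.map (fun p => p.1 k) = μ k := by
  rw [← Measure.infinitePi_map_eval μ k, ← h, Measure.fst, Measure.map_map (by fun_prop) (by fun_prop)]
  rfl

theorem lintegral_sq_fst {P : Measure ((ℕ → ℝ) × (ℕ → ℝ))} {v : ℕ → ℝ} (hv : ∀ k, 0 ≤ v k)
    (h : P.fst = Measure.infinitePi fun k => gaussianReal 0 (v k).toNNReal) (k : ℕ) :
    ∫⁻ p, ENNReal.ofReal (p.1 k ^ 2) ∂P = ENNReal.ofReal (v k) := by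
  have h1 := lintegral_sq_sub_gaussianReal 0 (hv k)
  rw [← map_fst_eval h k, lintegral_map (by fun_prop) (by fun_prop)] at h1
  simpa using h1

theorem integrable_and_integral_eq_of_lintegral {Ω : Type*} [MeasurableSpace Ω] {P : Measure Ω}
    {f : Ω → ℝ} (hf : Measurable f) (h0 : ∀ p, 0 ≤ f p) {c : ℝ} (hc : 0 ≤ c)
    (h : ∫⁻ p, ENNReal.ofReal (f p) ∂P = ENNReal.ofReal c) :
    Integrable f P ∧ ∫ p, f p ∂P = c := by
  refine ⟨⟨hf.aestronglyMeasurable, ?_⟩, ?_⟩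
  · rw [hasFiniteIntegral_iff_ofReal (ae_of_all _ h0), h]
    exact ENNReal.ofReal_lt_top
  · rw [integral_eq_lintegral_of_nonneg_ae (ae_of_all _ h0) hf.aestronglyMeasurable, h,
      ENNReal.toReal_ofReal hc]

theorem integral_gaussianLogRatio {Ω : Type*} [MeasurableSpace Ω] {P : Measure Ω}
    [IsProbabilityMeasure P] {X Y : Ω → ℝ} (v θ : ℝ) (hX : Integrable (fun p => X p ^ 2) P)
    (hXY : Integrable (fun p => (X p - Y p) ^ 2) P) :
    Integrable (fun p => gaussianLogRatio v θ (X p) (Y p)) P ∧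
      ∫ p, gaussianLogRatio v θ (X p) (Y p) ∂P =
        1 / 2 * Real.log (v / θ) + (∫ p, X p ^ 2 ∂P) / (2 * v) -
          (∫ p, (X p - Y p) ^ 2 ∂P) / (2 * θ) := by
  have i1 : Integrable (fun p => (X p - Y p) ^ 2 / (2 * θ)) P := hXY.div_const _
  have i2 : Integrable (fun p => 1 / 2 * Real.log (v / θ) + X p ^ 2 / (2 * v)) P :=
    (integrable_const _).add (hX.div_const _)
  refine ⟨i2.sub i1, ?_⟩
  simp only [gaussianLogRatio]
  rw [integral_sub i2 i1, integral_add (integrable_const _) (hX.div_const _), integral_div,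
    integral_div]
  simp

/-- Converse part of reverse waterfilling for independent Gaussian components. -/
theorem le_rateDistortion {v : ℕ → ℝ} (hv : ∀ k, 0 < v k) {θ : ℝ} (hθ : 0 < θ) {n N : ℕ}
    (hN : n ≤ N) (h2 : ∀ k, n ≤ k → v k ≤ θ) {D : ℝ} (hD : 0 ≤ D) :
    ENNReal.ofReal (∑ k ∈ Finset.range n, 1 / 2 * Real.log (v k / θ) +
        (n * θ + ∑ k ∈ Finset.Ico n N, v k - D) / (2 * θ)) ≤
      rateDistortion (Measure.infinitePi fun k => gaussianReal 0 (v k).toNNReal) D := by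
  refine le_iInf fun P => le_iInf fun hP => le_iInf fun hfst => le_iInf fun hdist => ?_
  -- Below the water level `v k` is replaced by `θ` in the log-ratio, which kills the logarithm.
  -- Only `N` components are tested, to keep the sum finite.
  set φ : ℕ → ℝ → ℝ → ℝ := fun k x y =>
    if k < n then gaussianLogRatio (v k) θ x y else x ^ 2 / (2 * θ) - (x - y) ^ 2 / (2 * θ) with hφ
  have hφm : ∀ k, Measurable fun p : ℝ × ℝ => φ k p.1 p.2 := by
    intro k
    by_cases hk : k < n
    · simp only [hφ, hk, if_true]; fun_prop
    · simp only [hφ, hk, if_false]; fun_prop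
  set f : (ℕ → ℝ) × (ℕ → ℝ) → ℝ := fun p => ∑ k ∈ Finset.range N, φ k (p.1 k) (p.2 k) with hf
  have hfm : Measurable f := Finset.measurable_sum _ fun k _ =>
    (hφm k).comp (f := fun p : (ℕ → ℝ) × (ℕ → ℝ) => (p.1 k, p.2 k)) (by fun_prop)
  have hd : ∀ k, ∫⁻ p, ENNReal.ofReal ((p.1 k - p.2 k) ^ 2) ∂P ≠ ∞ := by
    intro k
    refine ((lintegral_mono fun p => ?_).trans hdist).trans_lt ENNReal.ofReal_lt_top |>.ne
    exact ENNReal.le_tsum (f := fun k => ENNReal.ofReal ((p.1 k - p.2 k) ^ 2)) k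
  have hdI := fun k => integrable_and_integral_eq_of_lintegral (P := P)
    (f := fun p => (p.1 k - p.2 k) ^ 2) (by fun_prop) (fun p => sq_nonneg _)
    ENNReal.toReal_nonneg (ENNReal.ofReal_toReal (hd k)).symm
  set d : ℕ → ℝ := fun k => (∫⁻ p, ENNReal.ofReal ((p.1 k - p.2 k) ^ 2) ∂P).toReal with hdd
  have hxI := fun k => integrable_and_integral_eq_of_lintegral (P := P)
    (f := fun p => p.1 k ^ 2) (by fun_prop) (fun p => sq_nonneg _) (hv k).le
    (lintegral_sq_fst (fun k => (hv k).le) hfst k)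
  have hdsum : ∑ k ∈ Finset.range N, d k ≤ D := by
    rw [← ENNReal.ofReal_le_ofReal_iff hD]
    refine le_trans ?_ hdist
    rw [ENNReal.ofReal_sum_of_nonneg fun k _ => ENNReal.toReal_nonneg]
    rw [Finset.sum_congr rfl fun k _ => ENNReal.ofReal_toReal (hd k), ← lintegral_finsetSum _ (fun k _ => by fun_prop)]
    exact lintegral_mono fun p => ENNReal.sum_le_tsum _
  have hφI : ∀ k, Integrable (fun p => φ k (p.1 k) (p.2 k)) P ∧ ∫ p, φ k (p.1 k) (p.2 k) ∂P =
      if k < n then 1 / 2 * Real.log (v k / θ) + (θ - d k) / (2 * θ)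
      else (v k - d k) / (2 * θ) := by
    intro k
    have i1 := (hdI k).1.div_const (2 * θ)
    by_cases hk : k < n
    · simp only [hφ, hk, if_true]
      obtain ⟨h3, h4⟩ := integral_gaussianLogRatio (v k) θ (hxI k).1 (hdI k).1
      refine ⟨h3, ?_⟩
      rw [h4, (hxI k).2, (hdI k).2]
      have := (hv k).ne'
      change _ - d k / (2 * θ) = _
      field_simp
      ring
    · simp only [hφ, hk, if_false]
      have i2 := (hxI k).1.div_const (2 * θ)
      refine ⟨i2.sub i1, ?_⟩
      rw [integral_sub i2 i1, integral_div, integral_div, (hxI k).2, (hdI k).2, sub_div]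
  have hfI : Integrable f P := integrable_finsetSum _ fun k _ => (hφI k).1
  have hfval : ∑ k ∈ Finset.range n, 1 / 2 * Real.log (v k / θ) +
        (n * θ + ∑ k ∈ Finset.Ico n N, v k - D) / (2 * θ) ≤ ∫ p, f p ∂P := by
    rw [integral_finsetSum _ fun k _ => (hφI k).1]
    simp_rw [(hφI _).2]
    rw [← Finset.sum_range_add_sum_Ico _ hN, Finset.sum_congr rfl (g := fun k =>
      1 / 2 * Real.log (v k / θ) + (θ - d k) / (2 * θ)) (fun k hk => if_pos (Finset.mem_range.1 hk)),
      Finset.sum_congr (s₁ := Finset.Ico n N) rfl (g := fun k => (v k - d k) / (2 * θ))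
        (fun k hk => if_neg (Finset.mem_Ico.1 hk).1.not_gt),
      Finset.sum_add_distrib, ← Finset.sum_div, ← Finset.sum_div, Finset.sum_sub_distrib,
      Finset.sum_sub_distrib, add_assoc, ← add_div]
    rw [← Finset.sum_range_add_sum_Ico _ hN] at hdsum
    simp only [Finset.sum_const, Finset.card_range, nsmul_eq_mul]
    refine add_le_add_right (div_le_div_of_nonneg_right ?_ (by positivity)) _
    linarith
  refine (ENNReal.ofReal_le_ofReal hfval).trans ?_
  refine ofReal_integral_le_klDiv hfm hfI ?_
  -- The law of the reproduction is arbitrary, so the moment bound is proved for each fixed `y` by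
  -- integrating over the source, whose components are independent.
  rw [hfst, lintegral_prod_symm' _ (by fun_prop)]
  refine (lintegral_mono (g := fun _ => 1) fun y => ?_).trans (by simp)
  simp only [hf, Real.exp_sum]
  simp_rw [ENNReal.ofReal_prod_of_nonneg fun k _ => (Real.exp_pos _).le]
  rw [lintegral_infinitePi_prod _ _
    (F := fun k x => ENNReal.ofReal (Real.exp (φ k x (y k)))) fun k =>
      (Real.measurable_exp.comp ((hφm k).comp (f := fun x : ℝ => (x, y k)) (by fun_prop))).ennreal_ofReal]
  refine Finset.prod_le_one' fun k _ => ?_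
  by_cases hk : k < n
  · simp only [hφ, hk, if_true]
    exact (lintegral_exp_gaussianLogRatio_left (hv k) hθ _).le
  · simp only [hφ, hk, if_false]
    exact lintegral_exp_sub_gaussian_le (hv k).le hθ (h2 k (not_lt.1 hk)) _

theorem fst_withDensity_prod {S T : Type*} [MeasurableSpace S] [MeasurableSpace T] {μ : Measure S}
    {ν : Measure T} [SFinite μ] [SFinite ν] {G : S × T → ℝ≥0∞} (hG : Measurable G)
    (h : ∀ x, ∫⁻ y, G (x, y) ∂ν = 1) : ((μ.prod ν).withDensity G).fst = μ := by
  ext A hA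
  rw [Measure.fst_apply hA, withDensity_apply _ (measurable_fst hA), ← Set.prod_univ,
    ← Measure.prod_restrict, Measure.restrict_univ, lintegral_prod _ hG.aemeasurable]
  simp [h]

theorem snd_withDensity_prod {S T : Type*} [MeasurableSpace S] [MeasurableSpace T] {μ : Measure S}
    {ν : Measure T} [SFinite μ] [SFinite ν] {G : S × T → ℝ≥0∞} (hG : Measurable G)
    (h : ∀ y, ∫⁻ x, G (x, y) ∂μ = 1) : ((μ.prod ν).withDensity G).snd = ν := by
  ext A hA
  rw [Measure.snd_apply hA, withDensity_apply _ (measurable_snd hA), ← Set.univ_prod,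
    ← Measure.prod_restrict, Measure.restrict_univ, lintegral_prod_symm' _ hG]
  simp [h]

theorem tsum_ite_ofReal {v : ℕ → ℝ} (hv : ∀ k, 0 ≤ v k) (hvs : Summable v) {θ : ℝ} (hθ : 0 ≤ θ)
    (n : ℕ) : ∑' k, (if k < n then ENNReal.ofReal θ else ENNReal.ofReal (v k)) =
      ENNReal.ofReal (n * θ + ∑' k, v (k + n)) := by
  have h1 : ∑ k ∈ Finset.range n, (if k < n then ENNReal.ofReal θ else ENNReal.ofReal (v k)) =
      n * ENNReal.ofReal θ := by
    rw [Finset.sum_congr rfl (g := fun _ => ENNReal.ofReal θ)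
      (fun k hk => if_pos (Finset.mem_range.1 hk))]
    simp
  have h2 : ∀ k, (if k + n < n then ENNReal.ofReal θ else ENNReal.ofReal (v (k + n))) =
      ENNReal.ofReal (v (k + n)) := fun k => if_neg (by omega)
  rw [← Summable.sum_add_tsum_nat_add' (k := n)
    (f := fun k => if k < n then ENNReal.ofReal θ else ENNReal.ofReal (v k)) ENNReal.summable, h1, tsum_congr h2,
    ← ENNReal.ofReal_tsum_of_nonneg (fun k => hv _) ((summable_nat_add_iff n).2 hvs),
    ENNReal.ofReal_add (by positivity) (tsum_nonneg fun k => hv _),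
    ENNReal.ofReal_mul (by positivity), ENNReal.ofReal_natCast]

/-- Achievability part of reverse waterfilling for independent Gaussian components. -/
theorem rateDistortion_le {v : ℕ → ℝ} (hv : ∀ k, 0 < v k) (hvs : Summable v) {θ : ℝ} (hθ : 0 < θ)
    {n : ℕ} (h1 : ∀ k < n, θ ≤ v k) {D : ℝ} (hD : n * θ + ∑' k, v (k + n) ≤ D) :
    rateDistortion (Measure.infinitePi fun k => gaussianReal 0 (v k).toNNReal) D ≤
      ENNReal.ofReal (∑ k ∈ Finset.range n, 1 / 2 * Real.log (v k / θ)) := by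
  set μ := Measure.infinitePi fun k => gaussianReal 0 (v k).toNNReal with hμ
  -- Variances of the optimal reproduction: components below the water level are reproduced as zero.
  set w : ℕ → ℝ := fun k => if k < n then v k - θ else 0 with hw
  set ν := Measure.infinitePi fun k => gaussianReal 0 (w k).toNNReal with hν
  set g : ℕ → ℝ → ℝ → ℝ≥0∞ := fun k x y =>
    ENNReal.ofReal (Real.exp (gaussianLogRatio (v k) θ x y)) with hg
  have hgm : ∀ k, Measurable fun p : ℝ × ℝ => g k p.1 p.2 := fun k => by fun_prop
  set G : (ℕ → ℝ) × (ℕ → ℝ) → ℝ≥0∞ := fun p => ∏ k ∈ Finset.range n, g k (p.1 k) (p.2 k) with hG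
  have hGm : Measurable G := Finset.measurable_prod _ fun k _ =>
    (hgm k).comp (f := fun p : (ℕ → ℝ) × (ℕ → ℝ) => (p.1 k, p.2 k)) (by fun_prop)
  have hgx : ∀ k y, Measurable fun x => g k x y := fun k y =>
    (hgm k).comp (f := fun x : ℝ => (x, y)) (by fun_prop)
  have hgy : ∀ k x, Measurable fun y => g k x y := fun k x =>
    (hgm k).comp (f := fun y : ℝ => (x, y)) (by fun_prop)
  set P := (μ.prod ν).withDensity G with hP
  have hfst : P.fst = μ := by
    refine fst_withDensity_prod hGm fun x => ?_
    simp only [hG]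
    rw [hν, lintegral_infinitePi_prod _ _ (F := fun k y => g k (x k) y) fun k => hgy k _]
    refine Finset.prod_eq_one fun k hk => ?_
    have hk := Finset.mem_range.1 hk
    simp only [hw, hk, if_true]
    exact lintegral_exp_gaussianLogRatio_right hθ (h1 k hk) _
  have hsnd : P.snd = ν := by
    refine snd_withDensity_prod hGm fun y => ?_
    simp only [hG]
    rw [hμ, lintegral_infinitePi_prod _ _ (F := fun k x => g k x (y k)) fun k => hgx k _]
    exact Finset.prod_eq_one fun k _ => lintegral_exp_gaussianLogRatio_left (hv k) hθ _
  have hprob : IsProbabilityMeasure P := ⟨by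
    rw [← Measure.fst_univ, hfst]; exact measure_univ⟩
  have hx2 := lintegral_sq_fst (fun k => (hv k).le) hfst
  have hd1 : ∀ k < n, ∫⁻ p, ENNReal.ofReal ((p.1 k - p.2 k) ^ 2) ∂P = ENNReal.ofReal θ := by
    intro k hk
    rw [hP, lintegral_withDensity_eq_lintegral_mul _ hGm (by fun_prop),
      lintegral_prod_symm' _ (hGm.mul (by fun_prop))]
    have inner : ∀ y, ∫⁻ x, (G * fun p : (ℕ → ℝ) × (ℕ → ℝ) =>
        ENNReal.ofReal ((p.1 k - p.2 k) ^ 2)) (x, y) ∂μ = ENNReal.ofReal θ := by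
      intro y
      -- The squared error is absorbed into the `k`-th factor, so that the integrand remains a
      -- product over coordinates.
      have h2 : ∀ x : ℕ → ℝ, (G * fun p : (ℕ → ℝ) × (ℕ → ℝ) =>
          ENNReal.ofReal ((p.1 k - p.2 k) ^ 2)) (x, y) = ∏ j ∈ Finset.range n,
          (g j (x j) (y j) * if j = k then ENNReal.ofReal ((x j - y j) ^ 2) else 1) := by
        intro x
        rw [Finset.prod_mul_distrib, Finset.prod_ite_eq' (Finset.range n) k
          (fun j => ENNReal.ofReal ((x j - y j) ^ 2)), if_pos (Finset.mem_range.2 hk)]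
        rfl
      simp_rw [h2]
      rw [hμ, lintegral_infinitePi_prod _ _
        (F := fun j x => g j x (y j) * if j = k then ENNReal.ofReal ((x - y j) ^ 2) else 1)]
      · rw [Finset.prod_eq_single k]
        · simp only [if_true]
          have h3 := lintegral_sq_sub_gaussianReal (y k) hθ.le
          rw [← gaussianReal_withDensity_gaussianLogRatio (hv k) hθ (y k),
            lintegral_withDensity_eq_lintegral_mul _ (hgx k _) (by fun_prop)] at h3
          exact h3
        · intro j _ hj
          simp only [hj, if_false, mul_one]
          exact lintegral_exp_gaussianLogRatio_left (hv j) hθ _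
        · simp [hk]
      · intro j
        refine (hgx j _).mul ?_
        by_cases hj : j = k
        · simp only [hj, if_true]; fun_prop
        · simp only [hj, if_false]; fun_prop
    rw [lintegral_congr inner]
    simp
  have hd2 : ∀ k, n ≤ k → ∫⁻ p, ENNReal.ofReal ((p.1 k - p.2 k) ^ 2) ∂P = ENNReal.ofReal (v k) := by
    intro k hk
    rw [← hx2 k]
    refine lintegral_congr_ae ?_
    have h2 : ∀ᵐ p ∂P, p.2 k = 0 := by
      have h3 : P.map (fun p => p.2 k) = Measure.dirac 0 := by
        rw [← gaussianReal_zero_var 0, show (0 : ℝ≥0) = (w k).toNNReal by simp [hw, hk.not_gt],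
          ← Measure.infinitePi_map_eval (fun k => gaussianReal 0 (w k).toNNReal) k, ← hν, ← hsnd,
          Measure.snd, Measure.map_map (by fun_prop) (by fun_prop)]
        rfl
      refine ae_of_ae_map (p := fun z : ℝ => z = 0) (f := fun p : (ℕ → ℝ) × (ℕ → ℝ) => p.2 k)
        (by fun_prop) ?_
      rw [h3, ae_dirac_eq]
      rfl
    filter_upwards [h2] with p hp
    rw [hp, sub_zero]
  have hdist : avgDistortion P ≤ ENNReal.ofReal D := by
    have hm : ∀ k, Measurable fun p : (ℕ → ℝ) × (ℕ → ℝ) =>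
        ENNReal.ofReal ((p.1 k - p.2 k) ^ 2) := fun k => by fun_prop
    have hd : ∀ k, ∫⁻ p, ENNReal.ofReal ((p.1 k - p.2 k) ^ 2) ∂P =
        if k < n then ENNReal.ofReal θ else ENNReal.ofReal (v k) := by
      intro k
      split_ifs with hk
      · exact hd1 k hk
      · exact hd2 k (not_lt.1 hk)
    rw [avgDistortion, lintegral_tsum fun k => (hm k).aemeasurable,
      tsum_congr hd, tsum_ite_ofReal (fun k => (hv k).le) hvs hθ.le]
    exact ENNReal.ofReal_le_ofReal hD
  refine (iInf_le_of_le P <| iInf_le_of_le hprob <| iInf_le_of_le hfst <| iInf_le_of_le hdist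
    (le_refl _)).trans ?_
  rw [mutualInfo, hfst, hsnd]
  have hllr : llr P (μ.prod ν) =ᵐ[P] fun p => ∑ k ∈ Finset.range n,
      gaussianLogRatio (v k) θ (p.1 k) (p.2 k) := by
    refine (withDensity_absolutelyContinuous _ _).ae_le ?_
    filter_upwards [Measure.rnDeriv_withDensity (μ.prod ν) hGm] with p hp
    rw [llr, hp]
    simp only [hG, hg]
    rw [← ENNReal.ofReal_prod_of_nonneg fun k _ => (Real.exp_pos _).le,
      ← Real.exp_sum, ENNReal.toReal_ofReal (Real.exp_pos _).le, Real.log_exp]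
  have hxI := fun k => integrable_and_integral_eq_of_lintegral (P := P)
    (f := fun p => p.1 k ^ 2) (by fun_prop) (fun p => sq_nonneg _) (hv k).le (hx2 k)
  have hdI := fun k hk => integrable_and_integral_eq_of_lintegral (P := P)
    (f := fun p => (p.1 k - p.2 k) ^ 2) (by fun_prop) (fun p => sq_nonneg _) hθ.le (hd1 k hk)
  have hgI := fun k (hk : k ∈ Finset.range n) => integral_gaussianLogRatio (v k) θ (hxI k).1
    (hdI k (Finset.mem_range.1 hk)).1
  rw [InformationTheory.klDiv_of_ac_of_integrable (withDensity_absolutelyContinuous _ _)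
    ((integrable_congr hllr).2 (integrable_finsetSum _ fun k hk => (hgI k hk).1)),
    integral_congr_ae hllr, integral_finsetSum _ fun k hk => (hgI k hk).1]
  refine ENNReal.ofReal_le_ofReal (le_of_eq ?_)
  simp only [probReal_univ, add_sub_cancel_right]
  refine Finset.sum_congr rfl fun k hk => ?_
  rw [(hgI k hk).2, (hxI k).2, (hdI k (Finset.mem_range.1 hk)).2]
  have := (hv k).ne'
  field_simp
  ring

/-! ### Mehler's formula through Gaussian averages -/

open Complex in
theorem integrable_add_I_mul_pow (x : ℝ) (n : ℕ) :
    Integrable (fun z : ℝ => ((x : ℂ) + I * z) ^ n) (gaussianReal 0 1) := by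
  have h1 : MemLp (fun z : ℝ => (x : ℂ) + I * z) n (gaussianReal 0 1) := by
    have h2 : MemLp (fun z : ℝ => (z : ℂ)) n (gaussianReal 0 1) :=
      (memLp_id_gaussianReal' (n : ℝ≥0∞) (by simp)).ofReal
    have h3 : MemLp (fun _ : ℝ => (x : ℂ)) n (gaussianReal 0 1) := memLp_const _
    have h4 : MemLp (fun z : ℝ => I * (z : ℂ)) n (gaussianReal 0 1) := h2.const_mul I
    exact h3.add h4
  have h3 := h1.integrable_norm_pow'
  simp_rw [← norm_pow] at h3
  exact (integrable_norm_iff (by fun_prop)).1 h3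

theorem integrable_gaussianReal_iff {E : Type*} [NormedAddCommGroup E] [NormedSpace ℝ E]
    {m : ℝ} {v : ℝ≥0} (hv : v ≠ 0) {f : ℝ → E} :
    Integrable f (gaussianReal m v) ↔ Integrable fun x => gaussianPDFReal m v x • f x := by
  rw [gaussianReal_of_var_ne_zero _ hv, integrable_withDensity_iff_integrable_smul'
    (measurable_gaussianPDF _ _) (ae_of_all _ fun _ => gaussianPDF_lt_top)]
  simp only [toReal_gaussianPDF]

theorem hasDerivAt_gaussianPDFReal (z : ℝ) :
    HasDerivAt (gaussianPDFReal 0 1) (-z * gaussianPDFReal 0 1 z) z := by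
  have h : HasDerivAt (fun z : ℝ => -(z - 0) ^ 2 / (2 * ((1 : ℝ≥0) : ℝ))) (-z) z := by
    have := (((hasDerivAt_id z).sub_const 0).pow 2).neg.div_const (2 * ((1 : ℝ≥0) : ℝ))
    convert! this using 1
    simp only [id, NNReal.coe_one]
    push_cast
    ring
  have h2 := h.exp.const_mul ((√(2 * Real.pi * ((1 : ℝ≥0) : ℝ)))⁻¹)
  convert! h2 using 1
  simp only [gaussianPDFReal]
  ring

-- Gaussian integration by parts: the difference of the two integrands, times the Gaussian density,
-- is minus the derivative of the density times `(x + I z) ^ n`.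
open Complex in
theorem integral_id_mul_add_I_mul_pow (x : ℝ) (n : ℕ) :
    ∫ z : ℝ, (z : ℂ) * ((x : ℂ) + I * z) ^ n ∂(gaussianReal 0 1) =
      n * I * ∫ z : ℝ, ((x : ℂ) + I * z) ^ (n - 1) ∂(gaussianReal 0 1) := by
  have hi1 : Integrable (fun z : ℝ => (z : ℂ) * ((x : ℂ) + I * z) ^ n) (gaussianReal 0 1) := by
    have h := ((integrable_add_I_mul_pow x (n + 1)).sub
      ((integrable_add_I_mul_pow x n).const_mul (x : ℂ))).const_mul (-I)
    refine h.congr (ae_of_all _ fun z => ?_)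
    simp only [Pi.sub_apply]
    linear_combination (-(z : ℂ) * ((x : ℂ) + I * z) ^ n) * I_sq
  have hi2 := (integrable_add_I_mul_pow x (n - 1)).const_mul (n * I)
  have hi0 := integrable_add_I_mul_pow x n
  rw [← sub_eq_zero, ← integral_const_mul, ← integral_sub hi1 hi2,
    integral_gaussianReal_eq_integral_smul one_ne_zero]
  rw [← neg_eq_zero, ← integral_neg]
  refine integral_eq_zero_of_hasDerivAt_of_integrable
    (f := fun z : ℝ => gaussianPDFReal 0 1 z • ((x : ℂ) + I * z) ^ n) (fun z => ?_) ?_ ?_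
  · have h1 : HasDerivAt (fun z : ℝ => ((x : ℂ) + I * z)) I z := by
      have := ((hasDerivAt_id z).ofReal_comp.const_mul I).const_add (x : ℂ)
      simpa using this
    have h2 := (hasDerivAt_gaussianPDFReal z).smul (h1.pow n)
    convert! h2 using 1
    simp only [Complex.real_smul, Pi.pow_apply]
    push_cast
    ring
  · exact ((integrable_gaussianReal_iff one_ne_zero).1 (hi1.sub hi2)).neg
  · exact (integrable_gaussianReal_iff one_ne_zero).1 hi0

/-- Turns the recursion `He_{n+1} = X He_n - He_n'` into the three-term recursion satisfied by the
Gaussian averages. -/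
theorem derivative_hermite (n : ℕ) :
    Polynomial.derivative (Polynomial.hermite n) = (n : Polynomial ℤ) * Polynomial.hermite (n - 1) := by
  induction n with
  | zero => simp
  | succ n ih =>
    rw [Polynomial.hermite_succ, Polynomial.derivative_sub, Polynomial.derivative_mul, ih,
      Polynomial.derivative_X, Polynomial.derivative_mul, Polynomial.derivative_natCast]
    rcases n with _ | n
    · simp
    · simp only [Nat.add_sub_cancel]
      rw [Polynomial.hermite_succ n]
      push_cast
      ring

/-- The Hermite polynomial is the Gaussian average of the monomial shifted along the imaginary
axis. -/
theorem aeval_hermite_eq_integral (x : ℝ) (n : ℕ) :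
    ((Polynomial.aeval x (Polynomial.hermite n) : ℝ) : ℂ) =
      ∫ z : ℝ, ((x : ℂ) + Complex.I * z) ^ n ∂(gaussianReal 0 1) := by
  induction n using Nat.strong_induction_on with
  | _ n ih =>
    rcases n with _ | n
    · simp
    have h1 : ∀ z : ℝ, ((x : ℂ) + Complex.I * z) ^ (n + 1) =
        x * ((x : ℂ) + Complex.I * z) ^ n + Complex.I * (z * ((x : ℂ) + Complex.I * z) ^ n) :=
      fun z => by ring
    have hi0 := integrable_add_I_mul_pow x n
    have hi1 : Integrable (fun z : ℝ => Complex.I * (z * ((x : ℂ) + Complex.I * z) ^ n))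
        (gaussianReal 0 1) := by
      refine ((integrable_add_I_mul_pow x (n + 1)).sub (hi0.const_mul (x : ℂ))).congr
        (ae_of_all _ fun z => ?_)
      simp only [Pi.sub_apply]
      ring
    simp_rw [h1]
    rw [integral_add (hi0.const_mul _) hi1, integral_const_mul, integral_const_mul,
      integral_id_mul_add_I_mul_pow, ← ih n (by omega), ← ih (n - 1) (by omega),
      Polynomial.hermite_succ, derivative_hermite]
    simp only [map_sub, map_mul, Polynomial.aeval_X, map_natCast]
    push_cast
    linear_combination (-(n : ℂ) * ((Polynomial.aeval x (Polynomial.hermite (n - 1)) : ℝ) : ℂ)) *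
      Complex.I_sq

-- The outer integral in Mehler's formula, after the second Gaussian variable has been integrated
-- out. Convergence needs `1 - q² > 0`.
open Complex in
theorem integral_cexp_quadratic_gaussianReal {q : ℝ} (hq0 : 0 ≤ q) (hq1 : q < 1) (x y : ℝ) :
    ∫ z : ℝ, cexp (q * (x + I * z) * y + (q * (x + I * z) * I) ^ 2 / 2) ∂(gaussianReal 0 1) =
      (((√(1 - q ^ 2))⁻¹ * Real.exp ((2 * q * x * y - q ^ 2 * (x ^ 2 + y ^ 2)) /
        (2 * (1 - q ^ 2))) : ℝ) : ℂ) := by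
  have hq : 0 < 1 - q ^ 2 := by nlinarith
  set b : ℝ := -(1 - q ^ 2) / 2 with hb
  have h1 : ∀ z : ℝ, gaussianPDFReal 0 1 z •
      cexp (q * (x + I * z) * y + (q * (x + I * z) * I) ^ 2 / 2) =
      ((√(2 * Real.pi))⁻¹ : ℝ) * cexp ((b : ℂ) * z ^ 2 + (q * (y - q * x) * I) * z +
        (q * x * y - q ^ 2 * x ^ 2 / 2)) := by
    intro z
    simp only [gaussianPDFReal, Complex.real_smul]
    push_cast
    rw [mul_assoc, ← Complex.exp_add]
    simp only [mul_one, hb]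
    congr 2
    push_cast
    linear_combination (q ^ 2 * x ^ 2 / 2 + q ^ 2 * z * x * I + q ^ 2 * z ^ 2 / 2 * (I ^ 2 - 1)) * I_sq
  rw [integral_gaussianReal_eq_integral_smul one_ne_zero]
  simp_rw [h1]
  rw [integral_const_mul, integral_cexp_quadratic (by rw [hb, ofReal_re]; linarith)]
  have h2 : ((Real.pi : ℂ) / -(b : ℂ)) ^ (1 / 2 : ℂ) = ((√(Real.pi / -b) : ℝ) : ℂ) := by
    rw [Real.sqrt_eq_rpow, Complex.ofReal_cpow (by rw [hb]; apply div_nonneg Real.pi_pos.le; linarith)]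
    push_cast
    rfl
  have h3 : cexp (q * x * y - q ^ 2 * x ^ 2 / 2 - (q * (y - q * x) * I) ^ 2 / (4 * (b : ℂ))) =
      ((Real.exp ((2 * q * x * y - q ^ 2 * (x ^ 2 + y ^ 2)) / (2 * (1 - q ^ 2))) : ℝ) : ℂ) := by
    push_cast
    congr 1
    have h4 : (1 - (q : ℂ) ^ 2) ≠ 0 := by exact_mod_cast hq.ne'
    rw [hb]
    push_cast
    rw [mul_pow _ I, I_sq]
    field_simp
    ring
  rw [h2, h3, ← mul_assoc, ← ofReal_mul, ← ofReal_mul]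
  congr 2
  rw [← Real.sqrt_inv, ← Real.sqrt_mul (by positivity), ← Real.sqrt_inv]
  congr 1
  rw [hb]
  have := Real.pi_pos
  field_simp

open Complex in
/-- **Mehler's formula** for the probabilists' Hermite polynomials. -/
theorem hasSum_mehler {q : ℝ} (hq0 : 0 ≤ q) (hq1 : q < 1) (x y : ℝ) :
    HasSum (fun n : ℕ => q ^ n / n.factorial * (Polynomial.aeval x (Polynomial.hermite n) *
        Polynomial.aeval y (Polynomial.hermite n)))
      ((√(1 - q ^ 2))⁻¹ * Real.exp ((2 * q * x * y - q ^ 2 * (x ^ 2 + y ^ 2)) /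
        (2 * (1 - q ^ 2)))) := by
  set G := gaussianReal 0 1 with hG
  set A : ℝ → ℂ := fun z => (x : ℂ) + I * z with hA
  set B : ℝ → ℂ := fun z => (y : ℂ) + I * z with hB
  have hAm : Continuous A := by fun_prop
  have hBm : Continuous B := by fun_prop
  have hexpsum : ∀ r : ℝ, HasSum (fun n : ℕ => r ^ n / n.factorial) (Real.exp r) := fun r => by
    rw [Real.exp_eq_exp_ℝ]; exact NormedSpace.expSeries_div_hasSum_exp r
  have hbnd : ∀ p : ℝ × ℝ, ∑' n : ℕ, (q * (‖A p.1‖ * ‖B p.2‖)) ^ n / n.factorial =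
      Real.exp (q * (‖A p.1‖ * ‖B p.2‖)) := fun p => (hexpsum _).tsum_eq
  have hsqA : ∀ z, ‖A z‖ ^ 2 = x ^ 2 + z ^ 2 := fun z => by
    rw [← Complex.normSq_eq_norm_sq]; simp [hA, Complex.normSq_apply]; ring
  have hsqB : ∀ z, ‖B z‖ ^ 2 = y ^ 2 + z ^ 2 := fun z => by
    rw [← Complex.normSq_eq_norm_sq]; simp [hB, Complex.normSq_apply]; ring
  have hIexp : ∀ u : ℝ, Integrable (fun z : ℝ => Real.exp (q / 2 * (u ^ 2 + z ^ 2))) G := by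
    intro u
    rw [hG, integrable_gaussianReal_iff one_ne_zero]
    have := (integrable_exp_neg_mul_sq (b := (1 - q) / 2) (by linarith)).const_mul
      ((√(2 * Real.pi))⁻¹ * Real.exp (q / 2 * u ^ 2))
    refine this.congr (ae_of_all _ fun z => ?_)
    simp only [gaussianPDFReal, smul_eq_mul, NNReal.coe_one, mul_one]
    rw [mul_assoc, mul_assoc, ← Real.exp_add, ← Real.exp_add]
    congr 2
    ring
  -- The inequality `2 ‖A‖ ‖B‖ ≤ ‖A‖² + ‖B‖²` separates the variables, and `q < 1` leaves a Gaussian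
  -- decay in each. This exponential dominates the whole series.
  have hint : Integrable (fun p : ℝ × ℝ => Real.exp (q * (‖A p.1‖ * ‖B p.2‖))) (G.prod G) := by
    refine ((hIexp x).mul_prod (hIexp y)).mono' (by fun_prop) (ae_of_all _ fun p => ?_)
    rw [Real.norm_of_nonneg (Real.exp_pos _).le, ← Real.exp_add]
    refine Real.exp_le_exp.2 ?_
    rw [← hsqA, ← hsqB]
    nlinarith [mul_nonneg hq0 (sq_nonneg (‖A p.1‖ - ‖B p.2‖))]
  have key := hasSum_integral_of_dominated_convergence (μ := G.prod G)
    (F := fun (n : ℕ) (p : ℝ × ℝ) => (q * (A p.1 * B p.2)) ^ n / n.factorial)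
    (f := fun p => cexp (q * (A p.1 * B p.2)))
    (fun n p => (q * (‖A p.1‖ * ‖B p.2‖)) ^ n / n.factorial)
    (fun n => by fun_prop)
    (fun n => ae_of_all _ fun p => by
      rw [norm_div, norm_pow, norm_mul, norm_mul, Complex.norm_real, Real.norm_of_nonneg hq0,
        Complex.norm_natCast])
    (ae_of_all _ fun p => (hexpsum _).summable) (by simp_rw [hbnd]; exact hint)
    (ae_of_all _ fun p => by
      rw [Complex.exp_eq_exp_ℂ]; exact NormedSpace.expSeries_div_hasSum_exp _)
  rw [← Complex.hasSum_ofReal]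
  convert! key using 1
  · ext n
    have : ∀ p : ℝ × ℝ, (q * (A p.1 * B p.2)) ^ n / (n.factorial : ℂ) =
        (q ^ n / n.factorial) * (A p.1 ^ n * B p.2 ^ n) := fun p => by ring_nf
    simp_rw [this]
    rw [integral_const_mul, integral_prod_mul (fun z => A z ^ n) (fun z => B z ^ n),
      ← aeval_hermite_eq_integral, ← aeval_hermite_eq_integral]
    push_cast
    ring
  · have hint' : Integrable (fun p : ℝ × ℝ => cexp (q * (A p.1 * B p.2))) (G.prod G) := by
      refine hint.mono' (by fun_prop) (ae_of_all _ fun p => ?_)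
      rw [Complex.norm_exp]
      refine Real.exp_le_exp.2 ((Complex.re_le_norm _).trans (le_of_eq ?_))
      rw [norm_mul, norm_mul, Complex.norm_real, Real.norm_of_nonneg hq0]
    rw [integral_prod _ hint', ← integral_cexp_quadratic_gaussianReal hq0 hq1]
    congr 1
    ext z
    have h1 : ∀ w : ℝ, cexp (q * (A z * B w)) = cexp (q * A z * y) * cexp (q * A z * I * w) := by
      intro w
      rw [← Complex.exp_add]
      congr 1
      simp only [hB]
      ring
    simp_rw [h1]
    -- The inner integral is the Gaussian moment generating function at the complex point `q * A z *
    -- I`.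
    have h2 := complexMGF_id_gaussianReal (μ := 0) (v := 1) (q * A z * I)
    simp only [complexMGF, id] at h2
    rw [integral_const_mul, h2, ← Complex.exp_add]
    simp [hA]

/-! ### Series with independent Gaussian coefficients -/

theorem lintegral_enorm_gaussianReal_le {v : ℝ} (hv : 0 < v) :
    ∫⁻ x, ‖x‖ₑ ∂(gaussianReal 0 v.toNNReal) ≤ ENNReal.ofReal √v := by
  have hs := Real.sqrt_pos.2 hv
  have h1 := lintegral_sq_sub_gaussianReal 0 hv.le
  simp only [sub_zero] at h1
  calc ∫⁻ x, ‖x‖ₑ ∂(gaussianReal 0 v.toNNReal)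
      ≤ ∫⁻ x, ENNReal.ofReal (√v / 2) + ENNReal.ofReal ((2 * √v)⁻¹) * ENNReal.ofReal (x ^ 2)
          ∂(gaussianReal 0 v.toNNReal) := by
        refine lintegral_mono fun x => ?_
        rw [Real.enorm_eq_ofReal_abs, ← ENNReal.ofReal_mul (by positivity),
          ← ENNReal.ofReal_add (by positivity) (by positivity)]
        refine ENNReal.ofReal_le_ofReal ?_
        have : √v / 2 + (2 * √v)⁻¹ * x ^ 2 - |x| = (√v - |x|) ^ 2 / (2 * √v) := by
          field_simp
          rw [← sq_abs x]
          ring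
        have h2 : 0 ≤ (√v - |x|) ^ 2 / (2 * √v) := by positivity
        linarith
    _ = ENNReal.ofReal √v := by
        rw [lintegral_add_left measurable_const, lintegral_const_mul _ (by fun_prop), h1,
          lintegral_const, measure_univ, mul_one, ← ENNReal.ofReal_mul (by positivity),
          ← ENNReal.ofReal_add (by positivity) (by positivity)]
        congr 1
        field_simp
        rw [Real.sq_sqrt hv.le]
        ring

section GaussianSeries

variable {v : ℕ → ℝ} (hv : ∀ k, 0 < v k) {a b : ℕ → ℝ}
  (ha : Summable fun k => √(v k) * |a k|) (hb : Summable fun k => √(v k) * |b k|)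

include hv

theorem lintegral_enorm_infinitePi_le (k : ℕ) :
    ∫⁻ w, ‖w k‖ₑ ∂(Measure.infinitePi fun k => gaussianReal 0 (v k).toNNReal) ≤
      ENNReal.ofReal √(v k) := by
  refine le_trans (le_of_eq ?_) (lintegral_enorm_gaussianReal_le (hv k))
  rw [← Measure.infinitePi_map_eval (fun k => gaussianReal 0 (v k).toNNReal) k,
    lintegral_map (by fun_prop) (by fun_prop)]

-- By Tonelli the expected sum of absolute values is at most `∑ √(v k) |a k|`, hence the sum is
-- almost surely finite.
include ha in
theorem ae_summable_gaussian :
    ∀ᵐ w ∂(Measure.infinitePi fun k => gaussianReal 0 (v k).toNNReal),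
      Summable fun k => ‖w k * a k‖ := by
  have h1 : ∫⁻ w, ∑' k, ‖w k * a k‖ₑ ∂(Measure.infinitePi fun k => gaussianReal 0 (v k).toNNReal)
      ≠ ∞ := by
    rw [lintegral_tsum fun k => (by fun_prop : Measurable fun w : ℕ → ℝ => ‖w k * a k‖ₑ).aemeasurable]
    refine ((ENNReal.tsum_le_tsum fun k => ?_).trans_lt (ha.tsum_ofReal_lt_top)).ne
    simp_rw [enorm_mul]
    rw [lintegral_mul_const _ (by fun_prop), ENNReal.ofReal_mul (by positivity),
      ← Real.enorm_eq_ofReal_abs]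
    gcongr
    exact lintegral_enorm_infinitePi_le hv k
  have h2 := ae_lt_top (Measurable.tsum fun k => by fun_prop) h1
  filter_upwards [h2] with w hw
  exact summable_norm_iff.2 (by
    refine Summable.of_norm ?_
    have := ENNReal.summable_toReal hw.ne
    simpa using this)

theorem integral_mul_infinitePi (j k : ℕ) :
    Integrable (fun w : ℕ → ℝ => w j * w k)
      (Measure.infinitePi fun k => gaussianReal 0 (v k).toNNReal) ∧
    ∫ w, w j * w k ∂(Measure.infinitePi fun k => gaussianReal 0 (v k).toNNReal) =
      if j = k then v k else 0 := by
  have hI : ∀ i, MemLp (fun w : ℕ → ℝ => w i) 2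
      (Measure.infinitePi fun k => gaussianReal 0 (v k).toNNReal) := by
    intro i
    have := memLp_id_gaussianReal' (μ := 0) (v := (v i).toNNReal) 2 (by simp)
    rw [← Measure.infinitePi_map_eval (fun k => gaussianReal 0 (v k).toNNReal) i] at this
    exact this.comp_of_map (measurable_pi_apply i).aemeasurable
  refine ⟨(hI j).integrable_mul (hI k), ?_⟩
  split_ifs with h
  · subst h
    have h1 := lintegral_sq_sub_gaussianReal 0 (hv j).le
    rw [← Measure.infinitePi_map_eval (fun k => gaussianReal 0 (v k).toNNReal) j,
      lintegral_map (by fun_prop) (by fun_prop)] at h1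
    have := (integrable_and_integral_eq_of_lintegral (by fun_prop) (fun p => sq_nonneg _) (hv j).le
      h1).2
    simpa [sq] using this
  · have hind : IndepFun (fun w : ℕ → ℝ => w j) (fun w : ℕ → ℝ => w k)
        (Measure.infinitePi fun k => gaussianReal 0 (v k).toNNReal) :=
      (iIndepFun_infinitePi (P := fun k => gaussianReal 0 (v k).toNNReal)
        (X := fun _ (x : ℝ) => x) (fun _ => measurable_id)).indepFun h
    have h0 : ∫ w, w j ∂(Measure.infinitePi fun k => gaussianReal 0 (v k).toNNReal) = 0 := by
      have := integral_id_gaussianReal (μ := 0) (v := (v j).toNNReal)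
      rw [← Measure.infinitePi_map_eval (fun k => gaussianReal 0 (v k).toNNReal) j,
        integral_map (measurable_pi_apply j).aemeasurable (by fun_prop)] at this
      exact this
    have := hind.integral_mul_eq_mul_integral (hI j).1 (hI k).1
    simp only [Pi.mul_apply] at this
    rw [this, h0, zero_mul]

-- The product is expanded into a double series and integrated term by term; independence and zero
-- means leave only the diagonal.
include ha hb in
theorem integral_tsum_mul_tsum_gaussian :
    ∫ w, (∑' k, w k * a k) * ∑' k, w k * b k
      ∂(Measure.infinitePi fun k => gaussianReal 0 (v k).toNNReal) = ∑' k, v k * (a k * b k) := by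
  set μ := Measure.infinitePi fun k => gaussianReal 0 (v k).toNNReal with hμ
  set F : ℕ × ℕ → (ℕ → ℝ) → ℝ := fun i w => (w i.1 * a i.1) * (w i.2 * b i.2) with hF
  have hFe : ∀ i w, F i w = (w i.1 * w i.2) * (a i.1 * b i.2) := fun i w => by
    simp only [hF]; ring
  have hFI : ∀ i, Integrable (F i) μ := fun i => by
    refine Integrable.congr ?_ (ae_of_all _ fun w => (hFe i w).symm)
    exact (integral_mul_infinitePi hv i.1 i.2).1.mul_const _
  have hFv : ∀ i, ∫ w, F i w ∂μ = if i.1 = i.2 then v i.2 * (a i.1 * b i.2) else 0 := fun i => by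
    simp_rw [hFe]
    rw [integral_mul_const, (integral_mul_infinitePi hv i.1 i.2).2]
    split_ifs <;> simp
  have hbound : ∀ i, ∫ w, ‖F i w‖ ∂μ ≤ (√(v i.1) * |a i.1|) * (√(v i.2) * |b i.2|) := by
    intro i
    have hs1 := Real.sqrt_pos.2 (hv i.1)
    have hs2 := Real.sqrt_pos.2 (hv i.2)
    have h1 := fun k => integral_mul_infinitePi hv k k
    -- Weighted arithmetic–geometric mean, with weights making both terms have expectation `√(v i.1)
    -- √(v i.2) / 2`; the bound then factorises over the two indices.
    have h2 : ∀ w : ℕ → ℝ, ‖F i w‖ ≤ ((w i.1 * w i.1) * (√(v i.2) / √(v i.1) / 2) +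
        (w i.2 * w i.2) * (√(v i.1) / √(v i.2) / 2)) * (|a i.1| * |b i.2|) := by
      intro w
      rw [hFe, norm_mul, norm_mul, norm_mul, Real.norm_eq_abs, Real.norm_eq_abs, Real.norm_eq_abs,
        Real.norm_eq_abs]
      refine mul_le_mul_of_nonneg_right ?_ (by positivity)
      have : (w i.1 * w i.1) * (√(v i.2) / √(v i.1) / 2) +
        (w i.2 * w i.2) * (√(v i.1) / √(v i.2) / 2) - |w i.1| * |w i.2| =
          (|w i.1| * √(v i.2) - |w i.2| * √(v i.1)) ^ 2 / (2 * √(v i.1) * √(v i.2)) := by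
        rw [← abs_mul_abs_self (w i.1), ← abs_mul_abs_self (w i.2)]
        field_simp
        ring
      have h3 : 0 ≤ (|w i.1| * √(v i.2) - |w i.2| * √(v i.1)) ^ 2 / (2 * √(v i.1) * √(v i.2)) := by
        positivity
      linarith
    have i1 := (h1 i.1).1.mul_const (√(v i.2) / √(v i.1) / 2)
    have i2 := (h1 i.2).1.mul_const (√(v i.1) / √(v i.2) / 2)
    refine (integral_mono (hFI i).norm ((i1.add i2).mul_const _) h2).trans (le_of_eq ?_)
    rw [integral_mul_const]
    simp only [Pi.add_apply]
    rw [integral_add i1 i2, integral_mul_const, integral_mul_const, (h1 _).2, (h1 _).2, if_pos rfl,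
      if_pos rfl]
    have e1 := Real.mul_self_sqrt (hv i.1).le
    have e2 := Real.mul_self_sqrt (hv i.2).le
    generalize √(v i.1) = s at *
    generalize √(v i.2) = t at *
    rw [← e1, ← e2]
    field_simp
    ring
  have hsum : Summable fun i => ∫ w, ‖F i w‖ ∂μ :=
    Summable.of_nonneg_of_le (fun i => integral_nonneg fun w => norm_nonneg _) hbound
      (ha.mul_of_nonneg hb (fun k => by positivity) (fun k => by positivity))
  have key := hasSum_integral_of_summable_integral_norm hFI hsum
  have h1 : ∫ w, (∑' k, w k * a k) * ∑' k, w k * b k ∂μ = ∫ w, ∑' i, F i w ∂μ := by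
    refine integral_congr_ae ?_
    filter_upwards [ae_summable_gaussian hv ha, ae_summable_gaussian hv hb] with w h2 h3
    exact tsum_mul_tsum_of_summable_norm h2 h3
  rw [h1, ← key.tsum_eq, key.summable.tsum_prod]
  refine tsum_congr fun k => ?_
  rw [tsum_eq_single k]
  · rw [hFv]; simp
  · intro j hj
    rw [hFv, if_neg (by simpa using hj.symm)]

end GaussianSeries

/-! ### The autocorrelation and the Wigner–Ville spectrum -/

theorem delta_pos {x : ℝ} (hx : 1 < x) : 0 < delta x :=
  Real.artanh_pos ⟨by positivity, (div_lt_one (by positivity)).2 hx⟩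

theorem one_div_mem_Ioo {x : ℝ} (hx : 1 < x) : 1 / x ∈ Set.Ioo (-1 : ℝ) 1 :=
  ⟨by have : 0 < 1 / x := by positivity
      linarith, (div_lt_one (by positivity)).2 hx⟩

theorem rho_pos (x : ℝ) : 0 < rho x := Real.exp_pos _

theorem rho_lt_one {x : ℝ} (hx : 1 < x) : rho x < 1 :=
  Real.exp_lt_one_iff.2 (neg_lt_zero.2 (delta_pos hx))

theorem rho_sq {x : ℝ} (hx : 1 < x) : rho x ^ 2 = (x - 1) / (x + 1) := by
  have h1 : 0 < 1 - 1 / x := by linarith [(one_div_mem_Ioo hx).2]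
  have h2 : 0 < 1 + 1 / x := by positivity
  rw [rho, Real.exp_neg, delta, Real.exp_artanh (one_div_mem_Ioo hx), inv_pow,
    Real.sq_sqrt (by positivity), inv_div]
  field_simp

theorem rho_eq_sqrt {x : ℝ} (hx : 1 < x) : rho x = √(x - 1) / √(x + 1) := by
  rw [← Real.sqrt_div (by linarith), ← rho_sq hx, Real.sqrt_sq (rho_pos x).le]

theorem cosh_delta {x : ℝ} (hx : 1 < x) : Real.cosh (delta x) = x / (√(x - 1) * √(x + 1)) := by
  rw [delta, Real.cosh_artanh (one_div_mem_Ioo hx), ← Real.sqrt_mul (by linarith)]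
  have : 1 - (1 / x) ^ 2 = ((x - 1) * (x + 1)) / x ^ 2 := by field_simp; ring
  rw [this, Real.sqrt_div (by nlinarith), Real.sqrt_sq (by linarith), one_div_div]

theorem sinh_delta {x : ℝ} (hx : 1 < x) : Real.sinh (delta x) = Real.cosh (delta x) / x := by
  have h := Real.tanh_artanh (one_div_mem_Ioo hx)
  rw [Real.tanh_eq_sinh_div_cosh, div_eq_iff (Real.cosh_pos _).ne'] at h
  rw [delta, h]
  ring

theorem coeffVar_pos {σ : ℝ} (hσ : 0 < σ) (x : ℝ) (k : ℕ) : 0 < coeffVar σ x k := by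
  have := rho_pos x
  unfold coeffVar
  positivity

/-- **Mehler's formula** for the Hermite functions. -/
theorem hasSum_mehler_hermiteFun {q : ℝ} (hq0 : 0 ≤ q) (hq1 : q < 1) (a b : ℝ) :
    HasSum (fun k : ℕ => q ^ k * (hermiteFun k a * hermiteFun k b))
      ((√Real.pi * √(1 - q ^ 2))⁻¹ * Real.exp (-((1 - q) / (1 + q) * ((a + b) / 2) ^ 2) -
        (1 + q) / (1 - q) * ((a - b) / 2) ^ 2)) := by
  have h := (hasSum_mehler hq0 hq1 (√2 * a) (√2 * b)).mul_left
    ((√Real.pi)⁻¹ * (Real.exp (-a ^ 2 / 2) * Real.exp (-b ^ 2 / 2)))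
  convert! h using 1
  · ext k
    have h1 : √((k.factorial : ℝ) * √Real.pi) * √((k.factorial : ℝ) * √Real.pi) =
        (k.factorial : ℝ) * √Real.pi := Real.mul_self_sqrt (by positivity)
    have h2 : √((k.factorial : ℝ) * √Real.pi) ≠ 0 := by positivity
    have h3 : (k.factorial : ℝ) ≠ 0 := by positivity
    have h4 : √Real.pi ≠ 0 := by positivity
    unfold hermiteFun
    rw [div_mul_div_comm, h1]
    field_simp
  · rw [mul_inv, mul_mul_mul_comm, ← Real.exp_add, ← Real.exp_add]
    congr 2
    have h1 : 1 - q ≠ 0 := by linarith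
    have h2 : 1 + q ≠ 0 := by linarith
    have h3 : 1 - q ^ 2 = (1 - q) * (1 + q) := by ring
    have e1 : 2 * q * (√2 * a) * (√2 * b) = 4 * q * a * b := by
      linear_combination (2 * q * a * b) * Real.mul_self_sqrt (zero_le_two (α := ℝ))
    have e2 : q ^ 2 * ((√2 * a) ^ 2 + (√2 * b) ^ 2) = 2 * q ^ 2 * (a ^ 2 + b ^ 2) := by
      linear_combination (q ^ 2 * (a ^ 2 + b ^ 2)) * Real.mul_self_sqrt (zero_le_two (α := ℝ))
    rw [e1, e2, h3]
    field_simp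
    ring

/-- Since `|h| ≤ 1 + h²`, Mehler's series on the diagonal suffices; no pointwise bound on Hermite
functions is required. -/
theorem summable_pow_mul_abs_hermiteFun {q : ℝ} (hq0 : 0 ≤ q) (hq1 : q < 1) (a : ℝ) :
    Summable fun k : ℕ => q ^ k * |hermiteFun k a| := by
  refine Summable.of_nonneg_of_le (fun k => by positivity) (fun k => ?_)
    ((summable_geometric_of_lt_one hq0 hq1).add (hasSum_mehler_hermiteFun hq0 hq1 a a).summable)
  rw [← mul_one_add]
  refine mul_le_mul_of_nonneg_left ?_ (by positivity)
  rw [← abs_mul_abs_self (hermiteFun k a)]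
  nlinarith [sq_nonneg (|hermiteFun k a| - 1), abs_nonneg (hermiteFun k a)]

theorem sqrt_coeffVar {σ : ℝ} (hσ : 0 < σ) (x : ℝ) (k : ℕ) :
    √(coeffVar σ x k) = σ * √(rho x) * rho x ^ k := by
  have : coeffVar σ x k = (σ * rho x ^ k) ^ 2 * rho x := by unfold coeffVar; ring
  have h := rho_pos x
  rw [this, Real.sqrt_mul (by positivity), Real.sqrt_sq (by positivity)]
  ring

theorem summable_sqrt_coeffVar_mul {σ : ℝ} (hσ : 0 < σ) {x : ℝ} (hx : 1 < x) (γ t : ℝ) :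
    Summable fun k => √(coeffVar σ x k) * |dilate γ (hermiteFun k) t| := by
  refine ((summable_pow_mul_abs_hermiteFun (rho_pos x).le (rho_lt_one hx) (t / γ)).mul_left
    (σ * √(rho x) * |(√γ)⁻¹|)).congr fun k => ?_
  rw [sqrt_coeffVar hσ, dilate, abs_mul]
  ring

/-- Mehler's formula with `q = ρ²`, for which `(1 - q) / (1 + q) = tanh δ = 1 / x`. The choice `γ² =
α / β` makes `x γ² = α²` and `x / γ² = β²`. -/
theorem autocorr_eq {σ α β : ℝ} (hσ : 0 < σ) (hα : 0 < α) (hβ : 0 < β) (hx : 1 < α * β)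
    (t s : ℝ) : autocorr σ α β (t + s / 2) (t - s / 2) =
      σ ^ 2 * (√(α * β - 1) * √(α * β + 1)) / (2 * α * √Real.pi) *
        Real.exp (-(t ^ 2 / α ^ 2) - β ^ 2 * s ^ 2 / 4) := by
  set x := α * β with hxdef
  set γ := √(α / β) with hγ
  have hγ0 : 0 < γ := Real.sqrt_pos.2 (by positivity)
  have hγ2 : γ ^ 2 = α / β := Real.sq_sqrt (by positivity)
  have hx0 : 0 < x := by linarith
  rw [autocorr]
  simp only [process, coeffLaw]
  rw [← hxdef, ← hγ, integral_tsum_mul_tsum_gaussian (coeffVar_pos hσ x)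
    (summable_sqrt_coeffVar_mul hσ hx _ _) (summable_sqrt_coeffVar_mul hσ hx _ _)]
  have hq0 : 0 ≤ rho x ^ 2 := sq_nonneg _
  have hq1 : rho x ^ 2 < 1 := pow_lt_one₀ (rho_pos x).le (rho_lt_one hx) two_ne_zero
  have h1 : ∀ k, coeffVar σ x k * (dilate γ (hermiteFun k) (t + s / 2) *
      dilate γ (hermiteFun k) (t - s / 2)) = (σ ^ 2 * rho x / γ) * ((rho x ^ 2) ^ k *
        (hermiteFun k ((t + s / 2) / γ) * hermiteFun k ((t - s / 2) / γ))) := by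
    intro k
    have : (√γ)⁻¹ * (√γ)⁻¹ = γ⁻¹ := by rw [← mul_inv, Real.mul_self_sqrt hγ0.le]
    rw [coeffVar, dilate, dilate, mul_mul_mul_comm (√γ)⁻¹, this, div_eq_mul_inv _ γ]
    ring
  simp_rw [h1]
  rw [tsum_mul_left, (hasSum_mehler_hermiteFun hq0 hq1 _ _).tsum_eq, ← mul_assoc]
  have e1 : 1 - (rho x ^ 2) ^ 2 = 4 * x / (x + 1) ^ 2 := by
    rw [rho_sq hx]; field_simp; ring
  have e2 : (1 - rho x ^ 2) / (1 + rho x ^ 2) = 1 / x := by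
    have : x + 1 ≠ 0 := by linarith
    have : x + 1 + (x - 1) ≠ 0 := by linarith
    rw [rho_sq hx]; field_simp; ring
  have e3 : (1 + rho x ^ 2) / (1 - rho x ^ 2) = x := by
    rw [← inv_div, e2, one_div, inv_inv]
  have e4 : √(4 * x / (x + 1) ^ 2) = 2 * √x / (x + 1) := by
    rw [Real.sqrt_div (by positivity), Real.sqrt_sq (by linarith), Real.sqrt_mul (by norm_num),
      show (4 : ℝ) = 2 ^ 2 by norm_num, Real.sqrt_sq (by norm_num)]
  have e5 : γ * √x = α := by
    rw [hγ, ← Real.sqrt_mul (by positivity), hxdef,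
      show α / β * (α * β) = α ^ 2 by field_simp, Real.sqrt_sq hα.le]
  congr 1
  · rw [e1, e4, rho_eq_sqrt hx, ← e5]
    have h2 : √(x + 1) * √(x + 1) = x + 1 := Real.mul_self_sqrt (by linarith)
    have h3 : 0 < √(x + 1) := Real.sqrt_pos.2 (by linarith)
    have h4 : 0 < √x := Real.sqrt_pos.2 hx0
    generalize √(x + 1) = r at *
    rw [← h2]
    field_simp
  · rw [e2, e3]
    congr 1
    have h2 : ((t + s / 2) / γ + (t - s / 2) / γ) / 2 = t / γ := by field_simp; ring
    have h3 : ((t + s / 2) / γ - (t - s / 2) / γ) / 2 = s / (2 * γ) := by field_simp; ring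
    rw [h2, h3, div_pow, div_pow, mul_pow, hγ2, hxdef]
    field_simp
    ring

/-- The peak value of the Wigner–Ville spectrum. -/
noncomputable def spectrumPeak (σ x : ℝ) : ℝ :=
  σ ^ 2 / (2 * Real.pi) * (1 / Real.cosh (delta x))

theorem wignerVilleC_eq {σ α β : ℝ} (hσ : 0 < σ) (hα : 0 < α) (hβ : 0 < β) (hx : 1 < α * β)
    (t ω : ℝ) : wignerVilleC σ α β t ω =
      ((spectrumPeak σ (α * β) * Real.exp (-(t ^ 2 / α ^ 2) - ω ^ 2 / β ^ 2) : ℝ) : ℂ) := by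
  have hb : (-(β ^ 2 / 4 : ℝ) : ℂ).re < 0 := by
    rw [← Complex.ofReal_neg, Complex.ofReal_re]
    have : 0 < β ^ 2 / 4 := by positivity
    linarith
  rw [wignerVilleC]
  have h1 : ∀ s : ℝ, Complex.exp (-(Complex.I * ω * s)) *
      (autocorr σ α β (t + s / 2) (t - s / 2) : ℂ) =
      ((σ ^ 2 * (√(α * β - 1) * √(α * β + 1)) / (2 * α * √Real.pi) : ℝ) : ℂ) *
        Complex.exp (-(β ^ 2 / 4 : ℝ) * (s : ℂ) ^ 2 + (-(Complex.I * ω)) * s +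
          (-(t ^ 2 / α ^ 2 : ℝ) : ℂ)) := by
    intro s
    rw [autocorr_eq hσ hα hβ hx, Complex.ofReal_mul, Complex.ofReal_exp, mul_left_comm,
      ← Complex.exp_add]
    congr 2
    push_cast
    ring
  simp_rw [h1]
  rw [integral_const_mul, integral_cexp_quadratic hb]
  have h2 : ((Real.pi : ℂ) / -(-(β ^ 2 / 4 : ℝ) : ℂ)) ^ (1 / 2 : ℂ) =
      ((2 * √Real.pi / β : ℝ) : ℂ) := by
    have : (2 * √Real.pi / β : ℝ) = (Real.pi / (β ^ 2 / 4)) ^ (1 / 2 : ℝ) := by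
      rw [← Real.sqrt_eq_rpow, show Real.pi / (β ^ 2 / 4) = (2 / β) ^ 2 * Real.pi by field_simp; norm_num,
        Real.sqrt_mul (by positivity), Real.sqrt_sq (by positivity)]
      ring
    rw [this, Complex.ofReal_cpow (by positivity)]
    push_cast
    rw [neg_neg]
  have h3 : Complex.exp ((-(t ^ 2 / α ^ 2 : ℝ) : ℂ) - (-(Complex.I * ω)) ^ 2 /
      (4 * (-(β ^ 2 / 4 : ℝ) : ℂ))) =
      ((Real.exp (-(t ^ 2 / α ^ 2) - ω ^ 2 / β ^ 2) : ℝ) : ℂ) := by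
    push_cast
    congr 1
    have : (β : ℂ) ≠ 0 := by exact_mod_cast hβ.ne'
    rw [neg_sq, mul_pow, Complex.I_sq]
    field_simp
  rw [h2, h3]
  have h4 : (2 * (Real.pi : ℂ))⁻¹ = (((2 * Real.pi)⁻¹ : ℝ) : ℂ) := by push_cast; rfl
  rw [h4, ← Complex.ofReal_mul, ← Complex.ofReal_mul, ← Complex.ofReal_mul]
  congr 1
  rw [← mul_assoc, ← mul_assoc, spectrumPeak, cosh_delta hx]
  congr 1
  have : 0 < √(α * β - 1) := Real.sqrt_pos.2 (by linarith)
  have : 0 < √(α * β + 1) := Real.sqrt_pos.2 (by linarith)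
  have := Real.pi_pos
  field_simp

/-! ### Integrals over the time-frequency plane -/

/-- Polar coordinates followed by `u = r²`: the Jacobian `r dr` becomes `du / 2`, and the angle
contributes `2π`. -/
theorem integral_comp_sq_add_sq {f : ℝ → ℝ} :
    ∫ p : ℝ × ℝ, f (p.1 ^ 2 + p.2 ^ 2) = Real.pi * ∫ u in Set.Ioi 0, f u := by
  have h1 : ∀ p : ℝ × ℝ, p.1 • f ((polarCoord.symm p).1 ^ 2 + (polarCoord.symm p).2 ^ 2) =
      (p.1 * f (p.1 ^ 2)) * 1 := by
    intro p
    simp only [polarCoord_symm_apply, smul_eq_mul, mul_one]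
    congr 2
    linear_combination p.1 ^ 2 * Real.sin_sq_add_cos_sq p.2
  rw [← integral_comp_polarCoord_symm (fun p : ℝ × ℝ => f (p.1 ^ 2 + p.2 ^ 2))]
  simp_rw [h1]
  rw [polarCoord_target, Measure.volume_eq_prod,
    setIntegral_prod_mul (fun r : ℝ => r * f (r ^ 2)) (fun _ : ℝ => (1 : ℝ)),
    ← integral_comp_rpow_Ioi_of_pos (g := f) (two_pos (α := ℝ))]
  have h2 : ∀ r : ℝ, (2 * r ^ ((2 : ℝ) - 1)) • f (r ^ (2 : ℝ)) = 2 * (r * f (r ^ 2)) := by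
    intro r
    rw [show (2 : ℝ) - 1 = 1 by norm_num, Real.rpow_one, Real.rpow_two, smul_eq_mul, mul_assoc]
  simp_rw [h2]
  rw [integral_const_mul, setIntegral_const, measureReal_def, Real.volume_Ioo,
    ENNReal.toReal_ofReal (by linarith [Real.pi_pos])]
  simp only [smul_eq_mul]
  ring

theorem integral_comp_ellipse {f : ℝ → ℝ} (hf : Continuous f) {α β : ℝ} (hα : 0 < α) (hβ : 0 < β) :
    ∫ p : ℝ × ℝ, f (p.1 ^ 2 / α ^ 2 + p.2 ^ 2 / β ^ 2) =
      Real.pi * (α * β) * ∫ u in Set.Ioi 0, f u := by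
  have h1 : ∀ p : ℝ × ℝ, f (p.1 ^ 2 / α ^ 2 + p.2 ^ 2 / β ^ 2) =
      (fun p : ℝ × ℝ => f (p.1 ^ 2 + p.2 ^ 2)) (Prod.map (α⁻¹ * ·) (β⁻¹ * ·) p) := by
    intro p
    simp only [Prod.map_fst, Prod.map_snd]
    congr 1
    field_simp
  simp_rw [h1]
  rw [← integral_map (f := fun p : ℝ × ℝ => f (p.1 ^ 2 + p.2 ^ 2))
      (φ := Prod.map (α⁻¹ * ·) (β⁻¹ * ·)) (by fun_prop) (by fun_prop), Measure.volume_eq_prod,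
    ← Measure.map_prod_map _ _ (by fun_prop) (by fun_prop), Real.map_volume_mul_left (by positivity),
    Real.map_volume_mul_left (by positivity), Measure.prod_smul_left, Measure.prod_smul_right,
    integral_smul_measure, integral_smul_measure, ← Measure.volume_eq_prod,
    integral_comp_sq_add_sq, inv_inv, inv_inv, abs_of_pos hα, abs_of_pos hβ,
    ENNReal.toReal_ofReal hα.le, ENNReal.toReal_ofReal hβ.le]
  simp only [smul_eq_mul]
  ring

/-- The water depth `ln⁺(c / l)`. -/
noncomputable def waterDepth (c l : ℝ) : ℝ := max 0 (Real.log (c / l))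

theorem waterDepth_nonneg (c l : ℝ) : 0 ≤ waterDepth c l := le_max_left _ _

theorem integral_Ioi_eq_add {f : ℝ → ℝ} (hf : IntegrableOn f (Set.Ioi 0)) {L : ℝ} (hL : 0 ≤ L) :
    ∫ u in Set.Ioi 0, f u = (∫ u in Set.Ioc 0 L, f u) + ∫ u in Set.Ioi L, f u := by
  rw [← Set.Ioc_union_Ioi_eq_Ioi hL, setIntegral_union (Set.Ioc_disjoint_Ioi le_rfl)
    measurableSet_Ioi (hf.mono_set Set.Ioc_subset_Ioi_self) (hf.mono_set (Set.Ioi_subset_Ioi hL))]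

/-- The integrand is constant up to the water depth and exponential beyond it. If `l ≥ c` the depth
is zero and the whole mass `c` remains. -/
theorem integral_min_exp {c l : ℝ} (hc : 0 < c) (hl : 0 < l) :
    ∫ u in Set.Ioi 0, min l (c * Real.exp (-u)) =
      c * (Real.exp (-waterDepth c l) * (1 + waterDepth c l)) := by
  have hint : IntegrableOn (fun u => min l (c * Real.exp (-u))) (Set.Ioi 0) := by
    refine ((integrableOn_exp_neg_Ioi 0).const_mul c).mono' (by fun_prop) (ae_of_all _ fun u => ?_)
    rw [Real.norm_of_nonneg (by positivity)]
    exact min_le_right _ _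
  have hexp : c * Real.exp (-Real.log (c / l)) = l := by
    rw [Real.exp_neg, Real.exp_log (by positivity)]; field_simp
  have h0 := waterDepth_nonneg c l
  have h1 : ∫ u in Set.Ioc 0 (waterDepth c l), min l (c * Real.exp (-u)) =
      ∫ u in Set.Ioc 0 (waterDepth c l), c * Real.exp (-waterDepth c l) := by
    refine setIntegral_congr_fun measurableSet_Ioc fun u hu => ?_
    have hpos : 0 < waterDepth c l := hu.1.trans_le hu.2
    have hW : waterDepth c l = Real.log (c / l) :=
      max_eq_right (le_of_lt (by simpa [waterDepth] using hpos))
    rw [hW, hexp, min_eq_left]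
    rw [← hexp, ← hW]
    gcongr
    exact hu.2
  have h2 : ∫ u in Set.Ioi (waterDepth c l), min l (c * Real.exp (-u)) =
      ∫ u in Set.Ioi (waterDepth c l), c * Real.exp (-u) := by
    refine setIntegral_congr_fun measurableSet_Ioi fun u hu => min_eq_right ?_
    rw [← hexp]
    gcongr
    exact (le_max_right _ _).trans (le_of_lt hu)
  rw [integral_Ioi_eq_add hint h0, h1, h2, setIntegral_const, integral_const_mul,
    integral_exp_neg_Ioi, measureReal_def, Real.volume_Ioc, sub_zero, ENNReal.toReal_ofReal h0,
    smul_eq_mul]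
  ring

theorem integral_max_log_sub {L : ℝ} :
    ∫ u in Set.Ioi 0, max 0 (1 / 2 * (L - u)) = (max 0 L) ^ 2 / 4 := by
  have h2 : ∀ u ∈ Set.Ioi (max 0 L), max 0 (1 / 2 * (L - u)) = 0 := by
    intro u hu
    have : L < u := (le_max_right _ _).trans_lt hu
    exact max_eq_left (by linarith)
  have h1 : ∀ u ∈ Set.Ioc 0 (max 0 L), max 0 (1 / 2 * (L - u)) = 1 / 2 * (max 0 L - u) := by
    intro u hu
    have hpos : 0 < max 0 L := hu.1.trans_le hu.2
    have hW : max 0 L = L := max_eq_right (le_of_lt (by simpa using hpos))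
    rw [hW] at hu ⊢
    exact max_eq_right (by linarith [hu.2])
  have hint : IntegrableOn (fun u => max 0 (1 / 2 * (L - u))) (Set.Ioi 0) := by
    rw [← Set.Ioc_union_Ioi_eq_Ioi (le_max_left 0 L)]
    refine IntegrableOn.union ?_ ?_
    · exact ((by fun_prop : Continuous fun u : ℝ => max 0 (1 / 2 * (L - u))).integrableOn_Icc).mono_set
        Set.Ioc_subset_Icc_self
    · exact integrableOn_zero.congr_fun (fun u hu => (h2 u hu).symm) measurableSet_Ioi
  rw [integral_Ioi_eq_add hint (le_max_left 0 L), setIntegral_congr_fun measurableSet_Ioc h1,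
    setIntegral_congr_fun measurableSet_Ioi h2, ← intervalIntegral.integral_of_le (le_max_left 0 L),
    intervalIntegral.integral_const_mul, intervalIntegral.integral_sub (by simp) (by simp)]
  simp
  ring

section Densities

variable {σ α β : ℝ} (hσ : 0 < σ) (hα : 0 < α) (hβ : 0 < β) (hx : 1 < α * β) {l : ℝ} (hl : 0 < l)

include hσ in
theorem spectrumPeak_pos (x : ℝ) : 0 < spectrumPeak σ x := by
  have := Real.cosh_pos (delta x)
  have := Real.pi_pos
  unfold spectrumPeak
  positivity

include hσ hα hβ hx

theorem wignerVille_eq (p : ℝ × ℝ) : wignerVille σ α β p =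
    spectrumPeak σ (α * β) * Real.exp (-(p.1 ^ 2 / α ^ 2 + p.2 ^ 2 / β ^ 2)) := by
  rw [wignerVille, wignerVilleC_eq hσ hα hβ hx, Complex.ofReal_re, neg_add']

theorem integrable_wignerVille : Integrable (wignerVille σ α β) := by
  have h1 := (integrable_exp_neg_mul_sq (b := (α ^ 2)⁻¹) (by positivity)).mul_prod
    (integrable_exp_neg_mul_sq (b := (β ^ 2)⁻¹) (by positivity))
  refine (h1.const_mul (spectrumPeak σ (α * β))).congr (ae_of_all _ fun p => ?_)
  simp only
  rw [wignerVille_eq hσ hα hβ hx, ← Real.exp_add]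
  congr 2
  ring

theorem continuous_wignerVille : Continuous (wignerVille σ α β) := by
  rw [funext (wignerVille_eq hσ hα hβ hx)]
  fun_prop

theorem wignerVille_pos (p : ℝ × ℝ) : 0 < wignerVille σ α β p := by
  rw [wignerVille_eq hσ hα hβ hx]
  exact mul_pos (spectrumPeak_pos hσ _) (Real.exp_pos _)

include hl

theorem integrable_distortionDensity : Integrable (distortionDensity σ α β l) := by
  have hm := continuous_wignerVille hσ hα hβ hx
  refine (integrable_wignerVille hσ hα hβ hx).mono' (by unfold distortionDensity; fun_prop)
    (ae_of_all _ fun p => ?_)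
  have := wignerVille_pos hσ hα hβ hx p
  rw [distortionDensity, Real.norm_of_nonneg (by positivity)]
  exact min_le_right _ _

theorem integrable_rateDensity : Integrable (rateDensity σ α β l) := by
  have hm := (continuous_wignerVille hσ hα hβ hx).measurable
  refine ((integrable_wignerVille hσ hα hβ hx).div_const l).mono'
    -- Domination by `Φ / l`, since `ln y ≤ y - 1`.
    (Measurable.aestronglyMeasurable (by unfold rateDensity; fun_prop)) (ae_of_all _ fun p => ?_)
  have := div_pos (wignerVille_pos hσ hα hβ hx p) hl
  rw [rateDensity, Real.norm_of_nonneg (le_max_left _ _)]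
  refine max_le this.le ?_
  have h2 := Real.log_le_sub_one_of_pos this
  linarith

theorem integral_distortionDensity : ∫ p, distortionDensity σ α β l p =
    Real.pi * (α * β) * (spectrumPeak σ (α * β) *
      (Real.exp (-waterDepth (spectrumPeak σ (α * β)) l) *
        (1 + waterDepth (spectrumPeak σ (α * β)) l))) := by
  rw [← integral_min_exp (spectrumPeak_pos hσ _) hl, ← integral_comp_ellipse (by fun_prop) hα hβ]
  simp only [distortionDensity, wignerVille_eq hσ hα hβ hx]

theorem integral_rateDensity : 1 / (2 * Real.pi) * ∫ p, rateDensity σ α β l p =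
    α * β * waterDepth (spectrumPeak σ (α * β)) l ^ 2 / 8 := by
  have hc := spectrumPeak_pos hσ (α * β)
  have h1 : ∀ p, rateDensity σ α β l p = max 0 (1 / 2 * (Real.log (spectrumPeak σ (α * β) / l) -
      (p.1 ^ 2 / α ^ 2 + p.2 ^ 2 / β ^ 2))) := by
    intro p
    rw [rateDensity, wignerVille_eq hσ hα hβ hx, mul_div_right_comm,
      Real.log_mul (by positivity) (by positivity), Real.log_exp]
    rfl
  simp_rw [h1]
  rw [integral_comp_ellipse (f := fun u => max 0 (1 / 2 *
    (Real.log (spectrumPeak σ (α * β) / l) - u))) (by fun_prop) hα hβ, integral_max_log_sub,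
    waterDepth]
  have := Real.pi_pos
  field_simp
  ring

end Densities

/-! ### Asymptotics of `δ` and the coefficient variances -/

theorem delta_eq_log {x : ℝ} (hx : 1 < x) : 2 * delta x = Real.log ((x + 1) / (x - 1)) := by
  rw [← inv_div, ← rho_sq hx, Real.log_inv, Real.log_pow, rho, Real.log_exp]
  push_cast
  ring

/-- With the companion upper bound, this squeezes `δ x` to `1`. Both come from `1 - 1/y ≤ ln y ≤ y -
1` at `y = (x + 1) / (x - 1)`. -/
theorem one_div_add_one_le_delta {x : ℝ} (hx : 1 < x) : 1 / (x + 1) ≤ delta x := by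
  have h := Real.one_sub_inv_le_log_of_pos (x := (x + 1) / (x - 1))
    (div_pos (by linarith) (by linarith))
  rw [← delta_eq_log hx, inv_div] at h
  have : 1 - (x - 1) / (x + 1) = 2 * (1 / (x + 1)) := by
    have : x + 1 ≠ 0 := by linarith
    field_simp; ring
  linarith

theorem delta_le_one_div_sub_one {x : ℝ} (hx : 1 < x) : delta x ≤ 1 / (x - 1) := by
  have h := Real.log_le_sub_one_of_pos (x := (x + 1) / (x - 1))
    (div_pos (by linarith) (by linarith))
  rw [← delta_eq_log hx] at h
  have : (x + 1) / (x - 1) - 1 = 2 * (1 / (x - 1)) := by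
    have : x - 1 ≠ 0 := by linarith
    field_simp; ring
  linarith

theorem tendsto_delta : Tendsto delta atTop (𝓝 0) := by
  have h : Tendsto (fun x : ℝ => 1 / (x - 1)) atTop (𝓝 0) := by
    simp only [one_div]
    exact tendsto_inv_atTop_zero.comp (tendsto_atTop_add_const_right _ _ tendsto_id)
  refine tendsto_of_tendsto_of_tendsto_of_le_of_le' tendsto_const_nhds h ?_ ?_
  · filter_upwards [eventually_gt_atTop 1] with x hx using (delta_pos hx).le
  · filter_upwards [eventually_gt_atTop 1] with x hx using delta_le_one_div_sub_one hx

theorem tendsto_one_div_delta_mul : Tendsto (fun x => 1 / (delta x * x)) atTop (𝓝 1) := by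
  have h0 : Tendsto (fun x : ℝ => 1 / x) atTop (𝓝 0) := by
    simpa only [one_div] using tendsto_inv_atTop_zero
  have h1 : Tendsto (fun x : ℝ => 1 - 1 / x) atTop (𝓝 1) := by simpa using h0.const_sub 1
  have h2 : Tendsto (fun x : ℝ => 1 + 1 / x) atTop (𝓝 1) := by simpa using h0.const_add 1
  refine tendsto_of_tendsto_of_tendsto_of_le_of_le' h1 h2 ?_ ?_
  · filter_upwards [eventually_gt_atTop 1] with x hx
    have hd := delta_pos hx
    have h := delta_le_one_div_sub_one hx
    rw [le_div_iff₀ (by linarith)] at h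
    rw [le_div_iff₀ (by positivity)]
    have : (1 - 1 / x) * (delta x * x) = delta x * (x - 1) := by field_simp
    linarith
  · filter_upwards [eventually_gt_atTop 1] with x hx
    have hd := delta_pos hx
    have h := one_div_add_one_le_delta hx
    rw [div_le_iff₀ (by linarith)] at h
    rw [div_le_iff₀ (by positivity)]
    have : (1 + 1 / x) * (delta x * x) = delta x * (x + 1) := by field_simp
    linarith

theorem coeffVar_eq (σ x : ℝ) (k : ℕ) :
    coeffVar σ x k = σ ^ 2 * Real.exp (-(delta x * (2 * k + 1))) := by
  rw [coeffVar, rho, ← Real.exp_nat_mul]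
  congr 2
  push_cast
  ring

theorem hasSum_coeffVar_nat_add (σ : ℝ) {x : ℝ} (hx : 1 < x) (n : ℕ) :
    HasSum (fun k => coeffVar σ x (k + n))
      (σ ^ 2 * Real.exp (-(2 * delta x * n)) * (x / (2 * Real.cosh (delta x)))) := by
  have h1 := rho_pos x
  have h2 : rho x ^ 2 < 1 := pow_lt_one₀ h1.le (rho_lt_one hx) two_ne_zero
  have h := (hasSum_geometric_of_lt_one (sq_nonneg (rho x)) h2).mul_left
    (σ ^ 2 * rho x ^ (2 * n + 1))
  have hc := Real.cosh_pos (delta x)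
  have hs : x / (2 * Real.cosh (delta x)) = 1 / (2 * Real.sinh (delta x)) := by
    rw [sinh_delta hx]; field_simp
  have e1 : rho x * (1 - rho x ^ 2)⁻¹ = x / (2 * Real.cosh (delta x)) := by
    have h3 : Real.exp (delta x) = (rho x)⁻¹ := by rw [rho, Real.exp_neg, inv_inv]
    have h4 : 2 * Real.sinh (delta x) = (rho x)⁻¹ - rho x := by
      rw [Real.sinh_eq, h3, rho]; ring
    have h5 : 1 - rho x ^ 2 ≠ 0 := by linarith
    rw [hs, h4]
    have h6 : (rho x)⁻¹ - rho x = (1 - rho x ^ 2) / rho x := by field_simp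
    rw [h6]
    field_simp
  have e2 : rho x ^ (2 * n) = Real.exp (-(2 * delta x * n)) := by
    rw [rho, ← Real.exp_nat_mul]
    congr 1
    push_cast
    ring
  rw [← e1, ← e2]
  convert! h using 1
  · ext k
    rw [coeffVar]
    ring
  · ring

theorem summable_coeffVar (σ : ℝ) {x : ℝ} (hx : 1 < x) : Summable (coeffVar σ x) :=
  (hasSum_coeffVar_nat_add σ hx 0).summable

theorem sourceEnergy_eq (σ : ℝ) {x : ℝ} (hx : 1 < x) :
    sourceEnergy σ x = σ ^ 2 * (x / (2 * Real.cosh (delta x))) := by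
  have := (hasSum_coeffVar_nat_add σ hx 0).tsum_eq
  simpa [sourceEnergy] using this

/-! ### Discrete waterfilling against its continuous approximation -/

/-- The number of coefficients whose variance is at least `σ² e^{-L}`. -/
noncomputable def activeCount (x L : ℝ) : ℕ := ⌊L / (2 * delta x) + 1 / 2⌋₊

/-- Index `k` is active when `δ (2k + 1) ≤ L`, that is `k + 1/2 ≤ L / (2δ)`; the shift by `1/2`
therefore makes the count a rounding to a nearest integer. -/
theorem abs_activeCount_sub_le {x L : ℝ} (hx : 1 < x) (hL : 0 ≤ L) :
    |(activeCount x L : ℝ) - L / (2 * delta x)| ≤ 1 / 2 := by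
  have hd := delta_pos hx
  have h1 := Nat.floor_le (a := L / (2 * delta x) + 1 / 2) (by positivity)
  have h2 := Nat.lt_floor_add_one (L / (2 * delta x) + 1 / 2)
  rw [abs_le, activeCount]
  constructor <;> linarith

theorem le_coeffVar_of_lt_activeCount {σ x L : ℝ} (hx : 1 < x) (hL : 0 ≤ L) {k : ℕ}
    (hk : k < activeCount x L) : σ ^ 2 * Real.exp (-L) ≤ coeffVar σ x k := by
  have hd := delta_pos hx
  have h1 := Nat.floor_le (a := L / (2 * delta x) + 1 / 2) (by positivity)
  have h2 : ((k + 1 : ℕ) : ℝ) ≤ activeCount x L := Nat.cast_le.2 hk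
  rw [activeCount] at h2
  push_cast at h2
  have h3 : (k : ℝ) + 1 / 2 ≤ L / (2 * delta x) := by linarith
  rw [le_div_iff₀ (by positivity)] at h3
  rw [coeffVar_eq]
  gcongr
  linarith

theorem coeffVar_le_of_activeCount_le {σ x L : ℝ} (hx : 1 < x) {k : ℕ}
    (hk : activeCount x L ≤ k) : coeffVar σ x k ≤ σ ^ 2 * Real.exp (-L) := by
  have hd := delta_pos hx
  have h1 := Nat.lt_floor_add_one (L / (2 * delta x) + 1 / 2)
  have h2 : (activeCount x L : ℝ) ≤ k := Nat.cast_le.2 hk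
  rw [activeCount] at h2
  have h3 : L / (2 * delta x) ≤ k + 1 / 2 := by linarith
  rw [div_le_iff₀ (by positivity)] at h3
  rw [coeffVar_eq]
  gcongr
  linarith

theorem sum_log_coeffVar {σ x : ℝ} (hσ : 0 < σ) (L : ℝ) (n : ℕ) :
    ∑ k ∈ Finset.range n, 1 / 2 * Real.log (coeffVar σ x k / (σ ^ 2 * Real.exp (-L))) =
      1 / 2 * (n * L - delta x * n ^ 2) := by
  have h1 : ∀ k, Real.log (coeffVar σ x k / (σ ^ 2 * Real.exp (-L))) =
      L - delta x * (2 * k + 1) := by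
    intro k
    rw [coeffVar_eq, mul_div_mul_left _ _ (by positivity), ← Real.exp_sub, Real.log_exp]
    ring
  simp_rw [h1]
  induction n with
  | zero => simp
  | succ n ih =>
    rw [Finset.sum_range_succ, ih]
    push_cast
    ring

/-- The sum of the log-ratios is `L² / (8 δ)` up to `δ / 8`. -/
theorem sum_log_coeffVar_bounds {σ x L : ℝ} (hσ : 0 < σ) (hx : 1 < x) (hL : 0 ≤ L) :
    ∑ k ∈ Finset.range (activeCount x L),
        1 / 2 * Real.log (coeffVar σ x k / (σ ^ 2 * Real.exp (-L))) ≤ L ^ 2 / (8 * delta x) ∧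
    L ^ 2 / (8 * delta x) - delta x / 8 ≤ ∑ k ∈ Finset.range (activeCount x L),
        1 / 2 * Real.log (coeffVar σ x k / (σ ^ 2 * Real.exp (-L))) := by
  have hd := delta_pos hx
  rw [sum_log_coeffVar hσ]
  set m : ℝ := (activeCount x L : ℝ) - L / (2 * delta x) with hm
  have h1 : m ^ 2 ≤ (1 / 2) ^ 2 := sq_le_sq' (abs_le.1 (abs_activeCount_sub_le hx hL)).1
    (abs_le.1 (abs_activeCount_sub_le hx hL)).2
  have h2 : (activeCount x L : ℝ) = m + L / (2 * delta x) := by rw [hm]; ring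
  -- Completing the square: `n L - δ n²` peaks at `n = L / (2δ)`, so the rounding error `m` enters
  -- only quadratically.
  have h3 : 1 / 2 * ((activeCount x L : ℝ) * L - delta x * (activeCount x L : ℝ) ^ 2) =
      L ^ 2 / (8 * delta x) - delta x / 2 * m ^ 2 := by
    rw [h2]; field_simp; ring
  rw [h3]
  constructor <;> nlinarith [sq_nonneg m]

/-- A bound, uniform in the water level, for the relative error of the continuous approximation
of the distortion. -/
noncomputable def distortionError (σ x : ℝ) : ℝ :=
  σ ^ 2 * (|1 / (delta x * x) - 1| / 2 + 1 / (2 * x) +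
    |Real.exp (delta x) / Real.cosh (delta x) - 1| / 2 +
    |Real.exp (-delta x) / Real.cosh (delta x) - 1| / 2)

theorem tendsto_distortionError (σ : ℝ) : Tendsto (distortionError σ) atTop (𝓝 0) := by
  have hcont : Continuous fun d : ℝ => |Real.exp d / Real.cosh d - 1| / 2 +
      |Real.exp (-d) / Real.cosh d - 1| / 2 := by
    have : ∀ d, Real.cosh d ≠ 0 := fun d => (Real.cosh_pos d).ne'
    fun_prop (disch := assumption)
  have h1 := (hcont.tendsto 0).comp tendsto_delta
  have h2 : Tendsto (fun x => |1 / (delta x * x) - 1| / 2) atTop (𝓝 0) := by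
    simpa using ((tendsto_one_div_delta_mul.sub_const 1).abs.div_const 2)
  have h3 : Tendsto (fun x : ℝ => 1 / (2 * x)) atTop (𝓝 0) := by
    simp only [one_div]
    exact tendsto_inv_atTop_zero.comp (tendsto_id.const_mul_atTop two_pos)
  have h4 := ((h2.add h3).add h1).const_mul (σ ^ 2)
  simp only [neg_zero, Real.exp_zero, Real.cosh_zero, div_one, sub_self, abs_zero, zero_div,
    add_zero, mul_zero] at h4
  refine h4.congr fun x => ?_
  simp only [distortionError, Function.comp]
  ring

/-- The fraction `e^{-L} (1 + L)` of the energy lost when the water depth is `L`. -/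
noncomputable def distortionFraction (L : ℝ) : ℝ := Real.exp (-L) * (1 + L)

theorem abs_exp_mul_sub_le {d c u : ℝ} (hc : 0 < c) (hu : |u| ≤ d) :
    |Real.exp u / c - 1| ≤ |Real.exp d / c - 1| + |Real.exp (-d) / c - 1| := by
  have h1 : Real.exp u / c ≤ Real.exp d / c := by gcongr; exact (abs_le.1 hu).2
  have h2 : Real.exp (-d) / c ≤ Real.exp u / c := by gcongr; exact (abs_le.1 hu).1
  have h3 := le_abs_self (Real.exp d / c - 1)
  have h4 := neg_abs_le (Real.exp (-d) / c - 1)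
  have h5 := abs_nonneg (Real.exp d / c - 1)
  have h6 := abs_nonneg (Real.exp (-d) / c - 1)
  rw [abs_le]
  constructor <;> linarith

/-- Three errors arise: replacing `1 / δ` by `x`, rounding the active count, and the factor
`e^{-2δm} / cosh δ` in the geometric tail. All are uniform in `L` because `e^{-L}` and `L e^{-L}`
are at most one. -/
theorem abs_distortion_sub_le {σ x L : ℝ} (hx : 1 < x) (hL : 0 ≤ L) :
    |(activeCount x L * (σ ^ 2 * Real.exp (-L)) + ∑' k, coeffVar σ x (k + activeCount x L)) -
      σ ^ 2 * distortionFraction L / 2 * x| ≤ distortionError σ x * x := by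
  have hd := delta_pos hx
  have hc := Real.cosh_pos (delta x)
  rw [(hasSum_coeffVar_nat_add σ hx _).tsum_eq]
  set m : ℝ := (activeCount x L : ℝ) - L / (2 * delta x) with hm
  have hmabs : |m| ≤ 1 / 2 := abs_activeCount_sub_le hx hL
  have h2 : (activeCount x L : ℝ) = m + L / (2 * delta x) := by rw [hm]; ring
  have h3 : Real.exp (-(2 * delta x * (activeCount x L : ℝ))) =
      Real.exp (-L) * Real.exp (-(2 * delta x * m)) := by
    rw [h2, ← Real.exp_add]; congr 1; field_simp; ring
  rw [h3, h2]
  have h4 : (m + L / (2 * delta x)) * (σ ^ 2 * Real.exp (-L)) +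
      σ ^ 2 * (Real.exp (-L) * Real.exp (-(2 * delta x * m))) * (x / (2 * Real.cosh (delta x))) -
      σ ^ 2 * distortionFraction L / 2 * x = σ ^ 2 * x * ((Real.exp (-L) * L) *
        ((1 / (delta x * x) - 1) / 2) + Real.exp (-L) * (m / x) + Real.exp (-L) *
        ((Real.exp (-(2 * delta x * m)) / Real.cosh (delta x) - 1) / 2)) := by
    rw [distortionFraction]
    field_simp
    ring
  have hx0 : 0 < x := by linarith
  have hE1 : Real.exp (-L) ≤ 1 := Real.exp_le_one_iff.2 (by linarith)
  have hE0 := Real.exp_pos (-L)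
  have hE2 : Real.exp (-L) * L ≤ 1 := by
    have := Real.add_one_le_exp L
    have h5 : Real.exp (-L) * Real.exp L = 1 := by rw [← Real.exp_add]; simp
    nlinarith
  have b1 : |(Real.exp (-L) * L) * ((1 / (delta x * x) - 1) / 2)| ≤
      |1 / (delta x * x) - 1| / 2 := by
    rw [abs_mul, abs_of_nonneg (by positivity : 0 ≤ Real.exp (-L) * L), abs_div, abs_two]
    exact mul_le_of_le_one_left (by positivity) hE2
  have b2 : |Real.exp (-L) * (m / x)| ≤ 1 / (2 * x) := by
    rw [abs_mul, abs_of_pos hE0, abs_div, abs_of_pos hx0]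
    refine (mul_le_of_le_one_left (by positivity) hE1).trans ?_
    rw [← div_div]
    gcongr
  have b3 : |Real.exp (-L) * ((Real.exp (-(2 * delta x * m)) / Real.cosh (delta x) - 1) / 2)| ≤
      |Real.exp (delta x) / Real.cosh (delta x) - 1| / 2 +
        |Real.exp (-delta x) / Real.cosh (delta x) - 1| / 2 := by
    rw [abs_mul, abs_of_pos hE0, abs_div, abs_two]
    refine (mul_le_of_le_one_left (by positivity) hE1).trans ?_
    rw [← add_div]
    refine div_le_div_of_nonneg_right (abs_exp_mul_sub_le hc ?_) (by norm_num)
    rw [abs_neg, abs_mul, abs_of_pos (by positivity : 0 < 2 * delta x)]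
    nlinarith
  rw [h4, abs_mul, abs_of_nonneg (by positivity : 0 ≤ σ ^ 2 * x), distortionError, mul_right_comm (σ ^ 2) _ x]
  refine mul_le_mul_of_nonneg_left ?_ (by positivity)
  refine (abs_add_le _ _).trans ?_
  have := abs_add_le ((Real.exp (-L) * L) * ((1 / (delta x * x) - 1) / 2))
    (Real.exp (-L) * (m / x))
  linarith

/-! ### Bounds for the rate of the source -/

theorem rateDistortion_coeffLaw_le {σ x L D : ℝ} (hσ : 0 < σ) (hx : 1 < x) (hL : 0 ≤ L)
    (hD : σ ^ 2 * distortionFraction L / 2 * x + distortionError σ x * x ≤ D) :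
    rateDistortion (coeffLaw σ x) D ≤ ENNReal.ofReal (L ^ 2 / (8 * delta x)) := by
  refine (rateDistortion_le (coeffVar_pos hσ x) (summable_coeffVar σ hx)
    (θ := σ ^ 2 * Real.exp (-L)) (by positivity) (n := activeCount x L)
    (fun k hk => le_coeffVar_of_lt_activeCount hx hL hk) ?_).trans
    (ENNReal.ofReal_le_ofReal (sum_log_coeffVar_bounds hσ hx hL).1)
  have := (abs_le.1 (abs_distortion_sub_le (σ := σ) hx hL)).2
  linarith

theorem le_rateDistortion_coeffLaw {σ x L D : ℝ} (hσ : 0 < σ) (hx : 1 < x) (hL : 0 ≤ L)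
    (hD : 0 ≤ D) :
    ENNReal.ofReal (L ^ 2 / (8 * delta x) - delta x / 8 + (σ ^ 2 * distortionFraction L / 2 * x -
      distortionError σ x * x - D) / (2 * (σ ^ 2 * Real.exp (-L)))) ≤
      rateDistortion (coeffLaw σ x) D := by
  set θ := σ ^ 2 * Real.exp (-L) with hθ
  have hθ0 : 0 < θ := by positivity
  set n := activeCount x L with hn
  have hb := fun N => le_rateDistortion (coeffVar_pos hσ x) hθ0 (Nat.le_add_left n N)
    (fun k hk => coeffVar_le_of_activeCount_le (L := L) hx hk) hD
  -- The converse tests finitely many components; letting their number grow recovers the full tail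
  -- energy.
  have hlim : Tendsto (fun N => ENNReal.ofReal (∑ k ∈ Finset.range n,
      1 / 2 * Real.log (coeffVar σ x k / θ) +
        (n * θ + ∑ k ∈ Finset.Ico n (N + n), coeffVar σ x k - D) / (2 * θ))) atTop
      (𝓝 (ENNReal.ofReal (∑ k ∈ Finset.range n, 1 / 2 * Real.log (coeffVar σ x k / θ) +
        (n * θ + ∑' k, coeffVar σ x (k + n) - D) / (2 * θ)))) := by
    refine ENNReal.tendsto_ofReal (Tendsto.const_add _ (Tendsto.div_const (Tendsto.sub_const
      (Tendsto.const_add _ ?_) _) _))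
    have := (hasSum_coeffVar_nat_add σ hx n).summable.hasSum.tendsto_sum_nat
    refine this.congr fun N => ?_
    rw [Finset.sum_Ico_eq_sum_range, Nat.add_sub_cancel]
    exact Finset.sum_congr rfl fun k _ => by rw [add_comm]
  refine le_trans (ENNReal.ofReal_le_ofReal ?_) (le_of_tendsto' hlim hb)
  have h1 := (sum_log_coeffVar_bounds hσ hx hL).2
  have h2 := (abs_le.1 (abs_distortion_sub_le (σ := σ) hx hL)).1
  refine add_le_add h1 (div_le_div_of_nonneg_right ?_ (by positivity))
  linarith

theorem rateDistortion_coeffLaw_ne_top {σ x D : ℝ} (hσ : 0 < σ) (hx : 1 < x) (hD : 0 < D) :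
    rateDistortion (coeffLaw σ x) D ≠ ∞ := by
  have hanti : Antitone (coeffVar σ x) := by
    have hd := delta_pos hx
    intro j k hjk
    rw [coeffVar_eq, coeffVar_eq]
    gcongr
  -- A crude water level suffices: the tail takes less than half of `D`, and a level at most `D /
  -- (2(n + 1))` spends at most the other half. The `n + 1` covers `n = 0`.
  obtain ⟨n, hn⟩ := ((tendsto_sum_nat_add (coeffVar σ x)).eventually
    (gt_mem_nhds (half_pos hD))).exists
  have hv := coeffVar_pos hσ x
  refine ((rateDistortion_le hv (summable_coeffVar σ hx)
    (θ := min (D / (2 * (n + 1))) (coeffVar σ x n)) (lt_min (by positivity) (hv n)) (n := n)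
    (fun k hk => (min_le_right _ _).trans (hanti hk.le)) (D := D) ?_).trans_lt
    ENNReal.ofReal_lt_top).ne
  have h1 : (n : ℝ) * min (D / (2 * (n + 1))) (coeffVar σ x n) ≤ n * (D / (2 * (n + 1))) := by
    gcongr
    exact min_le_left _ _
  have h2 : (n : ℝ) * (D / (2 * (n + 1))) ≤ D / 2 := by
    rw [mul_div_assoc', div_le_div_iff₀ (by positivity) (by positivity)]
    nlinarith
  linarith

/-! ### The distortion fraction and the choice of water level -/

theorem distortionFraction_pos {L : ℝ} (hL : 0 ≤ L) : 0 < distortionFraction L := by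
  unfold distortionFraction; positivity

theorem tendsto_distortionFraction : Tendsto distortionFraction atTop (𝓝 0) := by
  have h1 := Real.tendsto_pow_mul_exp_neg_atTop_nhds_zero 0
  have h2 := Real.tendsto_pow_mul_exp_neg_atTop_nhds_zero 1
  have h3 := h1.add h2
  rw [add_zero] at h3
  refine h3.congr fun L => ?_
  simp only [distortionFraction]
  ring

theorem continuous_distortionFraction : Continuous distortionFraction := by
  unfold distortionFraction; fun_prop

theorem distortionFraction_lt_one {κ : ℝ} (hκ : 0 < κ) : distortionFraction κ < 1 := by
  have h1 := Real.add_one_lt_exp hκ.ne'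
  have h2 : Real.exp (-κ) * Real.exp κ = 1 := by rw [← Real.exp_add]; simp
  have h3 := Real.exp_pos (-κ)
  unfold distortionFraction
  nlinarith

/-- Strict decrease, made uniform for depths up to `M`: the exact decrement is `e^{-L}` times a
quantity that is smallest at `L = 0`. -/
theorem distortionFraction_add_le {L κ M : ℝ} (hL : 0 ≤ L) (hκ : 0 ≤ κ) (hM : L ≤ M) :
    distortionFraction (L + κ) ≤
      distortionFraction L - Real.exp (-M) * (1 - distortionFraction κ) := by
  have h1 : distortionFraction L - distortionFraction (L + κ) =
      Real.exp (-L) * ((1 - distortionFraction κ) + L * (1 - Real.exp (-κ))) := by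
    simp only [distortionFraction]
    rw [neg_add, Real.exp_add]
    ring
  have h2 : Real.exp (-κ) ≤ 1 := Real.exp_le_one_iff.2 (by linarith)
  have h3 : distortionFraction κ ≤ 1 := by
    rcases hκ.eq_or_lt with rfl | h
    · simp [distortionFraction]
    · exact (distortionFraction_lt_one h).le
  have h4 : Real.exp (-M) ≤ Real.exp (-L) := Real.exp_le_exp.2 (by linarith)
  have h5 : Real.exp (-M) * (1 - distortionFraction κ) ≤
      Real.exp (-L) * ((1 - distortionFraction κ) + L * (1 - Real.exp (-κ))) := by
    refine mul_le_mul h4 ?_ (by linarith) (Real.exp_pos _).le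
    have : 0 ≤ L * (1 - Real.exp (-κ)) := mul_nonneg hL (by linarith)
    linarith
  linarith

theorem exists_distortionFraction_eq {y : ℝ} (hy0 : 0 < y) (hy1 : y ≤ 1) :
    ∃ L, 0 ≤ L ∧ distortionFraction L = y := by
  obtain ⟨M, hM, hM0⟩ := ((tendsto_distortionFraction.eventually (gt_mem_nhds hy0)).and
    (eventually_ge_atTop 0)).exists
  obtain ⟨L, hL, h⟩ := intermediate_value_Icc' hM0 continuous_distortionFraction.continuousOn
    (show y ∈ Set.Icc (distortionFraction M) (distortionFraction 0) from
      ⟨hM.le, by simpa [distortionFraction] using hy1⟩)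
  exact ⟨L, hL.1, h⟩

theorem exists_eventually_mul_le {D : ℝ → ℝ} (hD : IsBigOmega D fun x => x) :
    ∃ η > 0, ∀ᶠ x in atTop, η * x ≤ D x := by
  obtain ⟨r, hr0, hr⟩ := EReal.lt_iff_exists_real_btwn.1 hD.2
  refine ⟨r, by exact_mod_cast hr0, ?_⟩
  filter_upwards [eventually_lt_of_lt_liminf hr, eventually_gt_atTop 1] with x hx h1
  have : r < D x / x := by exact_mod_cast hx
  rw [lt_div_iff₀ (by linarith)] at this
  exact this.le

theorem pi_mul_spectrumPeak (σ : ℝ) {x : ℝ} (hx : 1 < x) :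
    Real.pi * x * spectrumPeak σ x = sourceEnergy σ x := by
  rw [sourceEnergy_eq σ hx, spectrumPeak]
  have := Real.pi_pos
  have := Real.cosh_pos (delta x)
  field_simp

theorem integral_distortionDensity_eq_sourceEnergy_mul {σ a b l : ℝ} (hσ : 0 < σ) (ha : 0 < a)
    (hb : 0 < b) (hx : 1 < a * b) (hl : 0 < l) : ∫ p, distortionDensity σ a b l p =
      sourceEnergy σ (a * b) * distortionFraction (waterDepth (spectrumPeak σ (a * b)) l) := by
  rw [integral_distortionDensity hσ ha hb hx hl, ← pi_mul_spectrumPeak σ hx, distortionFraction]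
  ring

theorem exists_waterLevel {σ : ℝ} (hσ : 0 < σ) {D : ℝ → ℝ} (hD : IsBigOmega D fun x => x)
    (hE : ∀ᶠ x in atTop, D x ≤ sourceEnergy σ x) :
    ∃ lam : ℝ → ℝ, (∀ x : ℝ, 1 < x → 0 < lam x) ∧ ∀ α β : ℝ → ℝ, IsParam α β →
      DotEq D (fun x => ∫ p : ℝ × ℝ, distortionDensity σ (α x) (β x) (lam x) p) := by
  obtain ⟨η, hη, hηD⟩ := exists_eventually_mul_le hD
  have hEpos : ∀ x, 1 < x → 0 < sourceEnergy σ x := by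
    intro x hx
    rw [sourceEnergy_eq σ hx]
    have := Real.cosh_pos (delta x)
    positivity
  -- For large `x` the level attains `D x` exactly; where `D x` is out of range it is set to `1`.
  have hex : ∀ x, ∃ l, 0 < l ∧ (1 < x → 0 < D x → D x ≤ sourceEnergy σ x →
      sourceEnergy σ x * distortionFraction (waterDepth (spectrumPeak σ x) l) = D x) := by
    intro x
    by_cases h : 1 < x ∧ 0 < D x ∧ D x ≤ sourceEnergy σ x
    · obtain ⟨hx, h0, h1⟩ := h
      have hEx := hEpos x hx
      have hc := spectrumPeak_pos hσ x
      obtain ⟨L, hL0, hL⟩ := exists_distortionFraction_eq (div_pos h0 hEx) ((div_le_one hEx).2 h1)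
      refine ⟨spectrumPeak σ x * Real.exp (-L), by positivity, fun _ _ _ => ?_⟩
      have hw : waterDepth (spectrumPeak σ x) (spectrumPeak σ x * Real.exp (-L)) = L := by
        rw [waterDepth, ← div_div, div_self hc.ne', one_div, Real.exp_neg, inv_inv, Real.log_exp,
          max_eq_right hL0]
      rw [hw, hL]
      field_simp
    · exact ⟨1, one_pos, fun h1 h2 h3 => absurd ⟨h1, h2, h3⟩ h⟩
  choose lam hlam0 hlam using hex
  refine ⟨lam, fun x _ => hlam0 x, fun α β hαβ => ?_⟩
  refine tendsto_const_nhds.congr' ?_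
  filter_upwards [hηD, hE, eventually_gt_atTop 1] with x h1 h2 hx
  obtain ⟨ha, hb, hab⟩ := hαβ x hx
  rw [integral_distortionDensity_eq_sourceEnergy_mul hσ ha hb (by rwa [hab]) (hlam0 x), hab,
    hlam x hx (lt_of_lt_of_le (by positivity) h1) h2, sub_self, zero_div]

/-! ### Stability of the rate and conclusion -/

/-- If the distortion is asymptotically the one of water depth `L`, then the rate is
asymptotically `x L² / 8`. -/
theorem dotEq_rateDistortion {σ : ℝ} (hσ : 0 < σ) {D L : ℝ → ℝ} (hD : IsBigOmega D fun x => x)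
    (hL : ∀ x, 0 ≤ L x)
    (hDL : DotEq D fun x => sourceEnergy σ x * distortionFraction (L x)) :
    DotEq (fun x => (rateDistortion (coeffLaw σ x) (D x)).toReal) (fun x => x * L x ^ 2 / 8) := by
  obtain ⟨η, hη, hηD⟩ := exists_eventually_mul_le hD
  have hfr1 : ∀ x, distortionFraction (L x) ≤ 1 := fun x => by
    rcases (hL x).eq_or_lt with h | h
    · simp [← h, distortionFraction]
    · exact (distortionFraction_lt_one h).le
  have hfr0 := fun x => distortionFraction_pos (hL x)
  -- the distortion in terms of the limiting energy density
  have hgap : Tendsto (fun x => D x / x - σ ^ 2 * distortionFraction (L x) / 2) atTop (𝓝 0) := by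
    have hcosh : Tendsto (fun x => |σ ^ 2 / (2 * Real.cosh (delta x)) - σ ^ 2 / 2|) atTop
        (𝓝 0) := by
      have hc : Continuous fun d => |σ ^ 2 / (2 * Real.cosh d) - σ ^ 2 / 2| := by
        have : ∀ d, 2 * Real.cosh d ≠ 0 := fun d => by have := Real.cosh_pos d; positivity
        fun_prop (disch := assumption)
      have := (hc.tendsto 0).comp tendsto_delta
      simpa [Function.comp_def] using this
    have h2 : Tendsto (fun x => (σ ^ 2 / (2 * Real.cosh (delta x)) - σ ^ 2 / 2) *
        distortionFraction (L x)) atTop (𝓝 0) := by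
      refine squeeze_zero_norm (fun x => ?_) hcosh
      rw [Real.norm_eq_abs, abs_mul, abs_of_pos (hfr0 x)]
      exact mul_le_of_le_one_right (abs_nonneg _) (hfr1 x)
    have h3 := Tendsto.add hDL h2
    rw [add_zero] at h3
    refine h3.congr' ?_
    filter_upwards [eventually_gt_atTop 1] with x hx
    have := Real.cosh_pos (delta x)
    rw [sourceEnergy_eq σ hx]
    field_simp
    ring
  -- the water depth is bounded
  obtain ⟨M, hM0, hM⟩ : ∃ M, 0 ≤ M ∧ ∀ᶠ x in atTop, L x ≤ M := by
    obtain ⟨M, hM⟩ := ((tendsto_distortionFraction.eventually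
      (gt_mem_nhds (show (0 : ℝ) < η / σ ^ 2 by positivity))).and
      (eventually_ge_atTop 0)).exists_forall_of_atTop
    refine ⟨M, (hM M le_rfl).2, ?_⟩
    filter_upwards [hηD, hgap.eventually (gt_mem_nhds (half_pos hη)), eventually_gt_atTop 1]
      with x h1 h2 hx
    by_contra hlt
    have h3 := (hM (L x) (not_le.1 hlt).le).1
    rw [lt_div_iff₀ (by positivity)] at h3
    have h4 : η ≤ D x / x := (le_div_iff₀ (by linarith)).2 h1
    linarith
  rw [DotEq, Metric.tendsto_atTop']
  intro ε hε
  obtain ⟨κ, hκ0, hκ⟩ : ∃ κ > 0, (2 * M * κ + κ ^ 2) / 8 < ε / 2 := by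
    have hc : Tendsto (fun κ : ℝ => (2 * M * κ + κ ^ 2) / 8) (𝓝[>] 0) (𝓝 0) := by
      have : Continuous fun κ : ℝ => (2 * M * κ + κ ^ 2) / 8 := by fun_prop
      simpa using (this.tendsto 0).mono_left nhdsWithin_le_nhds
    obtain ⟨κ, h1, h2⟩ := ((hc.eventually (gt_mem_nhds (half_pos hε))).and
      self_mem_nhdsWithin).exists
    exact ⟨κ, h2, h1⟩
  -- The distortion per unit of `x` that is freed, at any depth up to `M`, by deepening by `κ`.
  set ψ := σ ^ 2 / 2 * (Real.exp (-M) * (1 - distortionFraction κ)) with hψ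
  have hψ0 : 0 < ψ := by
    have := distortionFraction_lt_one hκ0
    have : 0 < 1 - distortionFraction κ := by linarith
    positivity
  have hlow : Tendsto (fun x => M ^ 2 / 8 * |1 / (delta x * x) - 1| + delta x / (8 * x) +
      (|D x / x - σ ^ 2 * distortionFraction (L x) / 2| + distortionError σ x) /
        (2 * (σ ^ 2 * Real.exp (-M)))) atTop (𝓝 0) := by
    have t1 := (tendsto_one_div_delta_mul.sub_const 1).abs.const_mul (M ^ 2 / 8)
    have t2 := tendsto_delta.div_atTop (tendsto_id.const_mul_atTop (show (0 : ℝ) < 8 by norm_num))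
    have t3 := (hgap.abs.add (tendsto_distortionError σ)).div_const (2 * (σ ^ 2 * Real.exp (-M)))
    simpa using (t1.add t2).add t3
  have hup : Tendsto (fun x => (M + κ) ^ 2 / 8 * |1 / (delta x * x) - 1|) atTop (𝓝 0) := by
    simpa using (tendsto_one_div_delta_mul.sub_const 1).abs.const_mul ((M + κ) ^ 2 / 8)
  have hmargin : Tendsto (fun x => |D x / x - σ ^ 2 * distortionFraction (L x) / 2| +
      distortionError σ x) atTop (𝓝 0) := by
    simpa using hgap.abs.add (tendsto_distortionError σ)
  have hfinal : ∀ᶠ x in atTop, dist (((rateDistortion (coeffLaw σ x) (D x)).toReal -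
      x * L x ^ 2 / 8) / x) 0 < ε := by
    filter_upwards [hηD, hM, eventually_gt_atTop 1, hlow.eventually (gt_mem_nhds hε),
      hup.eventually (gt_mem_nhds (half_pos hε)), hmargin.eventually (gt_mem_nhds hψ0)]
      with x hDx hMx hx hlo hu hm
    have hx0 : 0 < x := by linarith
    have hd := delta_pos hx
    have hLx := hL x
    have hD0 : 0 < D x := lt_of_lt_of_le (by positivity) hDx
    have hfin := rateDistortion_coeffLaw_ne_top hσ hx hD0
    have hDdiv : D x = D x / x * x := by field_simp
    have hG := abs_le.1 (le_refl |D x / x - σ ^ 2 * distortionFraction (L x) / 2|)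
    have hLM : L x ^ 2 ≤ M ^ 2 := by gcongr
    -- lower bound
    have hlower := le_rateDistortion_coeffLaw hσ hx hLx hD0.le
    rw [ENNReal.ofReal_le_iff_le_toReal hfin] at hlower
    -- upper bound
    have hupper : (rateDistortion (coeffLaw σ x) (D x)).toReal ≤ (L x + κ) ^ 2 / (8 * delta x) := by
      refine ENNReal.toReal_le_of_le_ofReal (by positivity)
        (rateDistortion_coeffLaw_le hσ hx (by positivity) ?_)
      have h1 := distortionFraction_add_le hLx hκ0.le hMx
      have h2 : σ ^ 2 * distortionFraction (L x + κ) / 2 ≤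
          σ ^ 2 * distortionFraction (L x) / 2 - ψ := by
        have := mul_le_mul_of_nonneg_left h1 (by positivity : 0 ≤ σ ^ 2 / 2)
        rw [hψ]
        linarith
      have h3 : σ ^ 2 * distortionFraction (L x + κ) / 2 + distortionError σ x ≤ D x / x := by
        linarith [hG.1]
      rw [hDdiv, ← add_mul]
      gcongr
    set R := (rateDistortion (coeffLaw σ x) (D x)).toReal with hR
    rw [Real.dist_0_eq_abs, abs_lt]
    have hRx : (R - x * L x ^ 2 / 8) / x = R / x - L x ^ 2 / 8 := by field_simp
    rw [hRx]
    constructor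
    · have h1 : L x ^ 2 / (8 * delta x) / x = L x ^ 2 / 8 + L x ^ 2 / 8 * (1 / (delta x * x) - 1) := by
        field_simp; ring
      have h2 : -(M ^ 2 / 8 * |1 / (delta x * x) - 1|) ≤ L x ^ 2 / 8 * (1 / (delta x * x) - 1) := by
        have h3 := neg_abs_le (1 / (delta x * x) - 1)
        have h4 := abs_nonneg (1 / (delta x * x) - 1)
        have h5 : 0 ≤ L x ^ 2 / 8 := by positivity
        nlinarith
      set N := σ ^ 2 * distortionFraction (L x) / 2 * x - distortionError σ x * x - D x with hN
      -- The bound `L x ≤ M` keeps the Lagrange multiplier `1/(2θ)` bounded.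
      have h3 : N / (2 * (σ ^ 2 * Real.exp (-L x))) / x ≥
          -((|D x / x - σ ^ 2 * distortionFraction (L x) / 2| + distortionError σ x) /
            (2 * (σ ^ 2 * Real.exp (-M)))) := by
        have herr : 0 ≤ distortionError σ x := by unfold distortionError; positivity
        have h4 : N / (2 * (σ ^ 2 * Real.exp (-L x))) / x =
            -((D x / x - σ ^ 2 * distortionFraction (L x) / 2 + distortionError σ x) /
              (2 * (σ ^ 2 * Real.exp (-L x)))) := by
          rw [hN]; field_simp; ring
        rw [h4, ge_iff_le, neg_le_neg_iff]
        gcongr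
        exact le_abs_self _
      have h5 : (L x ^ 2 / (8 * delta x) - delta x / 8 + N / (2 * (σ ^ 2 * Real.exp (-L x)))) / x ≤
          R / x := by gcongr
      rw [add_div, sub_div, h1, div_div (delta x)] at h5
      linarith
    · have h1 : (L x + κ) ^ 2 / (8 * delta x) / x =
          (L x + κ) ^ 2 / 8 + (L x + κ) ^ 2 / 8 * (1 / (delta x * x) - 1) := by
        field_simp; ring
      have h2 : (L x + κ) ^ 2 / 8 * (1 / (delta x * x) - 1) ≤
          (M + κ) ^ 2 / 8 * |1 / (delta x * x) - 1| :=
        (mul_le_mul_of_nonneg_left (le_abs_self _) (by positivity)).trans (by gcongr)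
      have h3 : R / x ≤ (L x + κ) ^ 2 / (8 * delta x) / x := by gcongr
      have h4 : L x * κ ≤ M * κ := by gcongr
      rw [h1] at h3
      nlinarith
  obtain ⟨a, ha⟩ := hfinal.exists_forall_of_atTop
  exact ⟨a, fun x hx => ha x hx.le⟩

theorem theorem3 (σ : ℝ) (hσ : 0 < σ) (D : ℝ → ℝ) (hD : IsBigOmega D (fun x => x)) :
    -- the process and its Wigner-Ville spectrum
    (∀ α β : ℝ, 0 < α → 0 < β → 1 < α * β →
      (∀ t : ℝ, ∀ᵐ w ∂(coeffLaw σ (α * β)),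
        Summable fun k : ℕ => w k * dilate (√(α / β)) (hermiteFun k) t) ∧
      (∀ t ω : ℝ, wignerVilleC σ α β t ω =
        ((σ ^ 2 / (2 * Real.pi) * (1 / Real.cosh (delta (α * β))) *
          Real.exp (-(t ^ 2 / α ^ 2) - ω ^ 2 / β ^ 2) : ℝ) : ℂ)) ∧
      (∀ l : ℝ, 0 < l →
        Integrable (rateDensity σ α β l) ∧ Integrable (distortionDensity σ α β l))) ∧
    -- the rate is finite
    (∀ x : ℝ, 1 < x → 0 < D x → rateDistortion (coeffLaw σ x) (D x) ≠ ∞) ∧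
    -- a water level exists if the distortion does not exceed the average energy
    ((∀ᶠ x in atTop, D x ≤ sourceEnergy σ x) →
      ∃ lam : ℝ → ℝ, (∀ x : ℝ, 1 < x → 0 < lam x) ∧
        ∀ α β : ℝ → ℝ, IsParam α β →
          DotEq D (fun x => ∫ p : ℝ × ℝ, distortionDensity σ (α x) (β x) (lam x) p)) ∧
    -- for every choice of the water level the rate is given by reverse waterfilling
    (∀ lam : ℝ → ℝ, (∀ x : ℝ, 1 < x → 0 < lam x) →
      ∀ α β : ℝ → ℝ, IsParam α β →
        DotEq D (fun x => ∫ p : ℝ × ℝ, distortionDensity σ (α x) (β x) (lam x) p) →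
        DotEq (fun x => (rateDistortion (coeffLaw σ x) (D x)).toReal)
          (fun x => (1 / (2 * Real.pi)) *
            ∫ p : ℝ × ℝ, rateDensity σ (α x) (β x) (lam x) p)) := by
  refine ⟨fun α β hα hβ hx => ⟨fun t => ?_, fun t ω => wignerVilleC_eq hσ hα hβ hx t ω,
      fun l hl => ⟨integrable_rateDensity hσ hα hβ hx hl,
        integrable_distortionDensity hσ hα hβ hx hl⟩⟩,
    fun x hx hDx => rateDistortion_coeffLaw_ne_top hσ hx hDx, exists_waterLevel hσ hD,
    fun lam hlam α β hαβ hlamD => ?_⟩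
  · filter_upwards [ae_summable_gaussian (coeffVar_pos hσ (α * β))
      (summable_sqrt_coeffVar_mul hσ hx (√(α / β)) t)] with w hw using hw.of_norm
  · have hev : ∀ᶠ x in atTop, 0 < α x ∧ 0 < β x ∧ α x * β x = x ∧ 1 < α x * β x ∧ 0 < lam x := by
      filter_upwards [eventually_gt_atTop 1] with x hx
      obtain ⟨ha, hb, hab⟩ := hαβ x hx
      exact ⟨ha, hb, hab, by rwa [hab], hlam x hx⟩
    refine (dotEq_rateDistortion hσ hD (fun x => waterDepth_nonneg (spectrumPeak σ x) (lam x))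
      (hlamD.congr' ?_)).congr' ?_
    · filter_upwards [hev] with x ⟨ha, hb, hab, hx, hl⟩
      rw [integral_distortionDensity_eq_sourceEnergy_mul hσ ha hb hx hl, hab]
    · filter_upwards [hev] with x ⟨ha, hb, hab, hx, hl⟩
      rw [integral_rateDensity hσ ha hb hx hl, hab]
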